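/- Let $\lambda_t>0$, $p\in[0,1]$, $\alpha>2$, $C_d,C_r,d_0>0$ and $N\in\mathbb N$. Transmitters (TXs) $T_k$ form a homogeneous Poisson point process of density $\lambda_t$ in the plane, and the typical user sits at the origin. The TXs and the assisting reconfigurable surfaces (RISs) form a Gauss--Poisson process: independently of everything else, each TX has, with probability $p$, an assisting RIS, placed uniformly on the circle of radius $d_0$ around it ($b_k=1$), and has none with probability $1-p$ ($b_k=0$). Let $d_{g,k}$ be the distance of $T_k$ from the origin, and let the user be served by the nearest TX, indexed by $0$, so that $d_{g,0}=\min_k d_{g,k}$. Let $g_k\sim\mathcal{CN}(0,1)$ be the direct channels (Rayleigh fading) and let $I_{r,k}\sim\mathcal{CN}(0,N)$ be the aggregate channels through the $N$ elements of an RIS not aligned to the user (the central-limit model for large $N$); all of these are independent of each other and of the Gauss--Poisson process. The direct path loss is $\eta_{g,k}=C_d\,d_{g,k}^{-\alpha}$ and, under the approximation that an interfering TX and its RIS are at the same distance from the user, the reflected path loss is $\eta_{h,k}=C_r(d_0d_{g,k})^{-\alpha}$. The interference power is $$I=\sum_{k\neq 0}\Big(b_k\big|\sqrt{\eta_{g,k}}\,g_k+\sqrt{\eta_{h,k}}\,I_{r,k}\big|^2+(1-b_k)\big|\sqrt{\eta_{g,k}}\,g_k\big|^2\Big).$$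 Then $I<\infty$ almost surely, and for every $s\ge 0$, almost surely, $$\mathbb E\big[e^{-sI}\,\big|\,d_{g,0}\big]=E_{n,1}(s)\,E_{n,2}(s),$$ where, with $e_1=C_d+NC_rd_0^{-\alpha}$, $$E_{n,1}(s)=\exp\Big(\pi\lambda_t\,p\,d_{g,0}^2\Big(1-{}_2F_1\big(1,-\tfrac2\alpha;1-\tfrac2\alpha;-e_1d_{g,0}^{-\alpha}s\big)\Big)\Big),$$ $$E_{n,2}(s)=\exp\Big(\pi\lambda_t(1-p)\,d_{g,0}^2\Big(1-{}_2F_1\big(1,-\tfrac2\alpha;1-\tfrac2\alpha;-C_dd_{g,0}^{-\alpha}s\big)\Big)\Big),$$ and ${}_2F_1$ is the Gauss hypergeometric function, analytically continued to $(-\infty,1)$. -/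

import Mathlib

open MeasureTheory ProbabilityTheory
open scoped NNReal ENNReal

namespace RISNetwork

noncomputable section

/-- The Euclidean plane; the typical user sits at its origin. -/
abbrev Plane : Type := EuclideanSpace ℝ (Fin 2)

/-! ### The hypergeometric function on `(-∞, 1)` -/

/-- `F` is an analytic continuation of the real Gauss hypergeometric series
`∑ (a)ₙ (b)ₙ / (c)ₙ xⁿ / n!` from `(-1, 1)` to `(-∞, 1)`. -/
def IsHypContinuation (a b c : ℝ) (F : ℝ → ℝ) : Prop :=
  AnalyticOnNhd ℝ F (Set.Iio 1) ∧ ∀ x ∈ Set.Ioo (-1 : ℝ) 1, F x = ordinaryHypergeometric a b c x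

open Classical in
/-- The Gauss hypergeometric function on `(-∞, 1)`: the analytic continuation of the
hypergeometric series (Mathlib's `ordinaryHypergeometric` is the sum of the series, which is
meaningful only for `|x| < 1`). -/
def hyp2F1 (a b c x : ℝ) : ℝ :=
  if h : ∃ F : ℝ → ℝ, IsHypContinuation a b c F then h.choose x else 0

/-- The continuation is unique on `(-∞, 1)`, so every continuation computes `hyp2F1`. -/
theorem hyp2F1_eq {a b c : ℝ} {F : ℝ → ℝ} (hF : IsHypContinuation a b c F) {x : ℝ} (hx : x < 1) :
    hyp2F1 a b c x = F x := by
  have h : ∃ F : ℝ → ℝ, IsHypContinuation a b c F := ⟨F, hF⟩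
  have hG := h.choose_spec
  rw [hyp2F1, dif_pos h]
  refine hG.1.eqOn_of_preconnected_of_eventuallyEq hF.1 (convex_Iio 1).isPreconnected
    (z₀ := 0) (by simp) ?_ (Set.mem_Iio.2 hx)
  filter_upwards [Ioo_mem_nhds (show (-1 : ℝ) < 0 by norm_num) (show (0 : ℝ) < 1 by norm_num)]
    with y hy
  rw [hG.2 y hy, hF.2 y hy]

/-! ### Laws -/

/-- The circularly symmetric complex Gaussian law `CN(0, v)`: independent centred real Gaussian
real and imaginary parts, each of variance `v / 2`. -/
def complexNormal (v : ℝ≥0) : Measure ℂ :=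
  ((gaussianReal 0 (v / 2)).prod (gaussianReal 0 (v / 2))).map
    (fun z : ℝ × ℝ => (⟨z.1, z.2⟩ : ℂ))

/-- The Bernoulli law: `true` with probability `p`, `false` with probability `1 - p`. -/
def bernoulliLaw (p : ℝ) : Measure Bool :=
  ENNReal.ofReal p • Measure.dirac true + ENNReal.ofReal (1 - p) • Measure.dirac false

/-- The uniform law on the circle of radius `r` about the origin. -/
def circleLaw (r : ℝ) : Measure Plane :=
  ((ENNReal.ofReal (2 * Real.pi))⁻¹ • volume.restrict (Set.Ioc (-Real.pi) Real.pi)).map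
    (fun θ : ℝ => (!₂[r * Real.cos θ, r * Real.sin θ] : Plane))

variable {Ω : Type*} [MeasurableSpace Ω]

/-! ### The point processes -/

/-- The number of points of the configuration `(X k ω)ₖ` in the set `A`. -/
def pointCount (X : ℕ → Ω → Plane) (A : Set Plane) (ω : Ω) : ℝ≥0∞ :=
  ∑' k, A.indicator (fun _ => (1 : ℝ≥0∞)) (X k ω)

/-- `(X k)ₖ` enumerates the points of a homogeneous Poisson point process of density `lam` in
the plane. -/
structure IsPoissonProcess (μ : Measure Ω) (lam : ℝ≥0) (X : ℕ → Ω → Plane) : Prop where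
  measurable : ∀ k, Measurable (X k)
  law : ∀ A : Set Plane, MeasurableSet A → volume A ≠ ∞ →
    HasLaw (pointCount X A)
      ((poissonMeasure (lam * (volume A).toNNReal)).map (fun n : ℕ => (n : ℝ≥0∞))) μ
  indep : ∀ (n : ℕ) (A : Fin n → Set Plane), (∀ i, MeasurableSet (A i)) →
    (∀ i, volume (A i) ≠ ∞) → Pairwise (fun i j => Disjoint (A i) (A j)) →
    iIndepFun (fun i => pointCount X (A i)) μ

/-- Gauss-Poisson process. The parent points (transmitters) `tx k` form a homogeneous Poisson
process. Independently of the parents and of each other, the clusters have two points with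
probability `p` (`hasRIS k = true`) and one point with probability `1 - p`. In a two-point cluster
the daughter point (the assisting surface) is `ris k`, uniformly distributed on the circle of
radius `d0` about its parent; for a one-point cluster `ris k` has no meaning and is not used. -/
structure IsGaussPoissonProcess (μ : Measure Ω) (lam : ℝ≥0) (p d0 : ℝ)
    (tx : ℕ → Ω → Plane) (hasRIS : ℕ → Ω → Bool) (ris : ℕ → Ω → Plane) : Prop where
  parents : IsPoissonProcess μ lam tx
  cluster_law : ∀ k, HasLaw (fun ω => (hasRIS k ω, ris k ω - tx k ω))
    ((bernoulliLaw p).prod (circleLaw d0)) μ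
  cluster_indep : iIndepFun (fun k ω => (hasRIS k ω, ris k ω - tx k ω)) μ
  parents_indep : IndepFun (fun ω k => tx k ω) (fun ω k => (hasRIS k ω, ris k ω - tx k ω)) μ

/-- Small-scale fading of the interfering channels: the direct channels `g k` are `CN(0, 1)`
(Rayleigh fading), and the aggregate channels `f k` through the `N` unaligned elements of a
surface are `CN(0, N)` (the central limit model for a large surface); all are independent. -/
structure IsFading (μ : Measure Ω) (N : ℕ) (g f : ℕ → Ω → ℂ) : Prop where
  law : ∀ k, HasLaw (fun ω => (g k ω, f k ω))
    ((complexNormal 1).prod (complexNormal (N : ℝ≥0))) μ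
  indep : iIndepFun (fun k ω => (g k ω, f k ω)) μ

/-! ### Nearest association and interference -/

/-- The (first) index of a transmitter closest to the origin. -/
def servingIndex (tx : ℕ → Ω → Plane) (ω : Ω) : ℕ :=
  sInf {k | ∀ j, ‖tx k ω‖ ≤ ‖tx j ω‖}

/-- The serving distance: the distance from the origin to the closest transmitter. -/
def servingDist (tx : ℕ → Ω → Plane) (ω : Ω) : ℝ :=
  ‖tx (servingIndex tx ω) ω‖

/-- Path loss of the direct link. -/
def directLoss (Cd α d : ℝ) : ℝ := Cd * d ^ (-α)

/-- Path loss of the link reflected at a surface at distance `d0` from its transmitter and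
distance `dr` from the user. -/
def reflectedLoss (Cr α d0 dr : ℝ) : ℝ := Cr * (d0 * dr) ^ (-α)

/-- Received power from an interfering transmitter at distance `dg`, with (`b = true`) or without
(`b = false`) an assisting surface at distance `dr` from the user. -/
def receivedPower (Cd Cr α d0 : ℝ) (b : Bool) (dg dr : ℝ) (g f : ℂ) : ℝ :=
  if b then
    ‖(Real.sqrt (directLoss Cd α dg) : ℂ) * g
      + (Real.sqrt (reflectedLoss Cr α d0 dr) : ℂ) * f‖ ^ 2
  else ‖(Real.sqrt (directLoss Cd α dg) : ℂ) * g‖ ^ 2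

/-- The interference power at the origin: the sum of the powers received from all transmitters
except the serving one. The distance approximation is in force: in the path loss of a reflected
link, the distance from the surface to the user is taken to be that of its transmitter. -/
def interference (Cd Cr α d0 : ℝ) (tx : ℕ → Ω → Plane) (hasRIS : ℕ → Ω → Bool)
    (g f : ℕ → Ω → ℂ) (ω : Ω) : ℝ≥0∞ :=
  ∑' k, if k = servingIndex tx ω then 0 else
    ENNReal.ofReal
      (receivedPower Cd Cr α d0 (hasRIS k ω) ‖tx k ω‖ ‖tx k ω‖ (g k ω) (f k ω))

/-- `e₁ = C_d + N C_r d₀^{-α}`. -/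
def e1 (Cd Cr α d0 : ℝ) (N : ℕ) : ℝ := Cd + N * Cr * d0 ^ (-α)

/-- `E_{n,1}(s)` as a function of the serving distance `d`. -/
def En1 (lam p α Cd Cr d0 : ℝ) (N : ℕ) (d s : ℝ) : ℝ :=
  Real.exp (Real.pi * lam * p * d ^ 2 *
    (1 - hyp2F1 1 (-(2 / α)) (1 - 2 / α) (-(e1 Cd Cr α d0 N * d ^ (-α) * s))))

/-- `E_{n,2}(s)` as a function of the serving distance `d`. -/
def En2 (lam p α Cd : ℝ) (d s : ℝ) : ℝ :=
  Real.exp (Real.pi * lam * (1 - p) * d ^ 2 *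
    (1 - hyp2F1 1 (-(2 / α)) (1 - 2 / α) (-(Cd * d ^ (-α) * s))))

end

end RISNetwork

/-! ### Exponentials of extended nonnegative series, and independence -/

namespace RISNetwork

open Filter Topology

/-! Everything is a Laplace transform of a sum over points. For a Poisson process,
`IsPoissonProcess.lintegral_expNeg_tsum` gives E exp(-∑ u(X_k)) = exp(-λ ∫ (1 - e^{-u})), and it is
essential that u may take the value ∞. Working with e^{-x} on [0, ∞] also means that no finiteness
of the interference has to be known in advance.

The marks are averaged out in two stages. Given positions and cluster types, a received power is the
squared modulus of a complex Gaussian, so it contributes a factor 1/(1 + c r^{-α}), with c = e₁ s or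
c = C_d s. Averaging over the cluster type gives a convex combination v(r) of the two factors. What
remains is a product of v(‖X_k‖) over the non-serving transmitters.

Conditioning on the nearest distance D is done without Palm calculus. Put T(a) = ∫_{r > a} r (1 -
v(r)) dr. Taking u = ∞ on the disc of radius a and u = -log v outside it shows that, under the
measure weighted by the product of v over all points, {D > a} has mass exp(-λ(πa² + 2πT(a))).
Differentiation gives the density 2πλ a v(a) exp(-λ(πa² + 2πT(a))). Removing the factor v(a) of the
serving point and comparing with the case v = 1 leaves the conditional transform exp(-2πλ T(D));
this is `IsPoissonProcess.lintegral_mul_expNeg_tsum_ite`.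

Since T is affine in v, the exponential splits into the two required factors, and each radial
integral is a hypergeometric value by `integral_Ioi_eq_hyp2F1`. Letting s → 0 in the transform shows
that the interference is almost surely finite. Testing against indicators of D turns the joint
transform into the conditional expectation. -/

/-- The function `x ↦ e⁻ˣ` on `[0, ∞]`, with value `0` at `∞`. -/
noncomputable def expNeg (x : ℝ≥0∞) : ℝ≥0∞ := (EReal.exp (x : EReal))⁻¹

@[simp] lemma expNeg_zero : expNeg 0 = 1 := by simp [expNeg]

@[simp] lemma expNeg_top : expNeg ∞ = 0 := by simp [expNeg]

lemma expNeg_ofReal {x : ℝ} (hx : 0 ≤ x) :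
    expNeg (ENNReal.ofReal x) = ENNReal.ofReal (Real.exp (-x)) := by
  rw [expNeg, EReal.coe_ennreal_ofReal, max_eq_left hx, EReal.exp_coe, Real.exp_neg,
    ENNReal.ofReal_inv_of_pos (Real.exp_pos x)]

lemma expNeg_of_ne_top {x : ℝ≥0∞} (hx : x ≠ ∞) :
    expNeg x = ENNReal.ofReal (Real.exp (-x.toReal)) := by
  rw [← expNeg_ofReal ENNReal.toReal_nonneg, ENNReal.ofReal_toReal hx]

lemma expNeg_le_one (x : ℝ≥0∞) : expNeg x ≤ 1 := by
  rw [expNeg, ENNReal.inv_le_one, EReal.one_le_exp_iff]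
  exact EReal.coe_ennreal_nonneg x

lemma expNeg_ne_top (x : ℝ≥0∞) : expNeg x ≠ ∞ :=
  ((expNeg_le_one x).trans_lt ENNReal.one_lt_top).ne

lemma expNeg_antitone : Antitone expNeg := fun x y h => by
  rw [expNeg, expNeg, ENNReal.inv_le_inv, EReal.exp_le_exp_iff]
  exact_mod_cast h

lemma continuous_expNeg : Continuous expNeg :=
  continuous_inv.comp (ENNReal.continuous_exp.comp continuous_coe_ennreal_ereal)

@[fun_prop]
lemma measurable_expNeg : Measurable expNeg := continuous_expNeg.measurable

lemma expNeg_add (x y : ℝ≥0∞) : expNeg (x + y) = expNeg x * expNeg y := by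
  rw [expNeg, expNeg, expNeg, EReal.coe_ennreal_add, EReal.exp_add, ENNReal.mul_inv]
  · left; simp
  · right; simp

lemma expNeg_sum {ι : Type*} (s : Finset ι) (f : ι → ℝ≥0∞) :
    expNeg (∑ i ∈ s, f i) = ∏ i ∈ s, expNeg (f i) := by
  classical
  induction s using Finset.induction_on with
  | empty => simp
  | insert a s ha ih => rw [Finset.sum_insert ha, Finset.prod_insert ha, expNeg_add, ih]

lemma tendsto_expNeg_sum_range (f : ℕ → ℝ≥0∞) :
    Tendsto (fun n => expNeg (∑ k ∈ Finset.range n, f k)) atTop (𝓝 (expNeg (∑' k, f k))) :=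
  (continuous_expNeg.tendsto _).comp (ENNReal.tendsto_nat_tsum f)

variable {Ω : Type*} [MeasurableSpace Ω]

/-- Bounded convergence for exponentials of random variables in `[0, ∞]`. -/
lemma tendsto_lintegral_expNeg {μ : Measure Ω} [IsFiniteMeasure μ] {f : ℕ → Ω → ℝ≥0∞}
    {g : Ω → ℝ≥0∞} (hf : ∀ n, AEMeasurable (f n) μ)
    (h : ∀ᵐ ω ∂μ, Tendsto (fun n => f n ω) atTop (𝓝 (g ω))) :
    Tendsto (fun n => ∫⁻ ω, expNeg (f n ω) ∂μ) atTop (𝓝 (∫⁻ ω, expNeg (g ω) ∂μ)) := by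
  refine tendsto_lintegral_of_dominated_convergence' (fun _ => 1)
    (fun n => measurable_expNeg.comp_aemeasurable (hf n))
    (fun n => ae_of_all _ fun ω => expNeg_le_one _) (by simp) ?_
  filter_upwards [h] with ω hω
  exact (continuous_expNeg.tendsto _).comp hω

/-- The Laplace transform of a series of functions of independent random elements. -/
theorem lintegral_expNeg_tsum_of_iIndepFun {μ : Measure Ω} [IsProbabilityMeasure μ]
    {E : Type*} [MeasurableSpace E] {M : ℕ → Ω → E} (hind : iIndepFun M μ)
    (hM : ∀ k, AEMeasurable (M k) μ) {u : ℕ → E → ℝ≥0∞} (hu : ∀ k, Measurable (u k))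
    {w : ℕ → ℝ≥0∞} (hw : ∀ k, ∫⁻ ω, expNeg (u k (M k ω)) ∂μ = expNeg (w k)) :
    ∫⁻ ω, expNeg (∑' k, u k (M k ω)) ∂μ = expNeg (∑' k, w k) := by
  have hfin (n : ℕ) : ∫⁻ ω, expNeg (∑ k ∈ Finset.range n, u k (M k ω)) ∂μ
      = expNeg (∑ k ∈ Finset.range n, w k) := by
    -- The product formula is applied to measurable modifications, because the `M k` are only almost
    -- everywhere measurable.
    have hi : iIndepFun (fun k ω => expNeg (u k ((hM k).mk _ ω))) μ :=
      (hind.congr fun k => (hM k).ae_eq_mk).comp (fun k x => expNeg (u k x))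
        fun k => measurable_expNeg.comp (hu k)
    have hae : ∀ᵐ ω ∂μ, ∀ k, M k ω = (hM k).mk _ ω := ae_all_iff.2 fun k => (hM k).ae_eq_mk
    rw [expNeg_sum]
    calc _ = ∫⁻ ω, ∏ k ∈ Finset.range n, expNeg (u k ((hM k).mk _ ω)) ∂μ := by
          refine lintegral_congr_ae ?_
          filter_upwards [hae] with ω hω
          rw [expNeg_sum]
          simp only [hω]
      _ = ∏ k ∈ Finset.range n, ∫⁻ ω, expNeg (u k ((hM k).mk _ ω)) ∂μ :=
          lintegral_prod_eq_prod_lintegral_of_indepFun _ _ hi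
            fun k => measurable_expNeg.comp ((hu k).comp (hM k).measurable_mk)
      _ = _ := by
          refine Finset.prod_congr rfl fun k _ => ?_
          rw [← hw k]
          refine lintegral_congr_ae ?_
          filter_upwards [hae] with ω hω
          rw [hω]
  refine tendsto_nhds_unique (tendsto_lintegral_expNeg
    (f := fun n ω => ∑ k ∈ Finset.range n, u k (M k ω)) (fun n => ?_)
    (ae_of_all _ fun ω => ENNReal.tendsto_nat_tsum _)) ?_
  · exact Finset.aemeasurable_fun_sum _ fun k _ => (hu k).comp_aemeasurable (hM k)
  · simp only [hfin]
    exact tendsto_expNeg_sum_range w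

/-- Fubini's theorem for independent random elements. -/
theorem lintegral_indepFun {μ : Measure Ω} [IsProbabilityMeasure μ] {E F : Type*}
    [MeasurableSpace E] [MeasurableSpace F] {X : Ω → E} {Y : Ω → F} (h : IndepFun X Y μ)
    (hX : AEMeasurable X μ) (hY : AEMeasurable Y μ) {Φ : E → F → ℝ≥0∞}
    (hΦ : Measurable (Function.uncurry Φ)) :
    ∫⁻ ω, Φ (X ω) (Y ω) ∂μ = ∫⁻ ω, ∫⁻ ω', Φ (X ω) (Y ω') ∂μ ∂μ := by
  have : IsProbabilityMeasure (μ.map Y) := Measure.isProbabilityMeasure_map hY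
  calc _ = ∫⁻ z, Function.uncurry Φ z ∂(μ.map fun ω => (X ω, Y ω)) := by
        rw [lintegral_map' hΦ.aemeasurable (hX.prodMk hY)]; rfl
    _ = ∫⁻ x, ∫⁻ y, Φ x y ∂(μ.map Y) ∂(μ.map X) := by
        rw [(indepFun_iff_map_prod_eq_prod_map_map hX hY).1 h, lintegral_prod _ hΦ.aemeasurable]
        rfl
    _ = _ := by
        have hm : Measurable fun x => ∫⁻ y, Φ x y ∂(μ.map Y) := hΦ.lintegral_prod_right'
        rw [lintegral_map' hm.aemeasurable hX]
        refine lintegral_congr fun ω => ?_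
        exact lintegral_map' (hΦ.comp measurable_prodMk_left).aemeasurable hY

end RISNetwork

/-! ### The Laplace functional of a Poisson process -/

namespace RISNetwork

open Filter Topology

lemma expNeg_mul_natCast (a : ℝ≥0∞) (n : ℕ) : expNeg (a * n) = expNeg a ^ n := by
  induction n with
  | zero => simp
  | succ n ih => rw [Nat.cast_succ, mul_add, mul_one, expNeg_add, ih, pow_succ]

/-- The Laplace transform of the Poisson law. -/
lemma lintegral_expNeg_poissonMeasure (m : ℝ≥0) (a : ℝ≥0∞) :
    ∫⁻ n : ℕ, expNeg (a * n) ∂(poissonMeasure m) = expNeg (m * (1 - expNeg a)) := by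
  -- With q = e^{-a} this is the generating function E q^n = e^{-m(1-q)}; the case a = ∞ is q = 0.
  obtain ⟨q, hq⟩ : ∃ q : ℝ≥0, expNeg a = q := ⟨_, (ENNReal.coe_toNNReal (expNeg_ne_top a)).symm⟩
  have hq1 : q ≤ 1 := by exact_mod_cast hq ▸ expNeg_le_one a
  have h1 : (m : ℝ≥0∞) * (1 - expNeg a) = ENNReal.ofReal (m * (1 - q)) := by
    rw [hq, ENNReal.ofReal_mul m.coe_nonneg, ENNReal.ofReal_sub _ q.coe_nonneg]
    simp
  have h0 : (0 : ℝ) ≤ m * (1 - q) :=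
    mul_nonneg m.coe_nonneg (sub_nonneg.2 (by exact_mod_cast hq1))
  have hs : HasSum (fun n : ℕ => Real.exp (-m) * ((q * m : ℝ) ^ n / n.factorial))
      (Real.exp (-m) * Real.exp (q * m)) := by
    rw [Real.exp_eq_exp_ℝ]
    exact (NormedSpace.expSeries_div_hasSum_exp (q * m : ℝ)).mul_left _
  rw [h1, expNeg_ofReal h0, lintegral_countable']
  have h2 (n : ℕ) : expNeg (a * n) * poissonMeasure m {n}
      = ENNReal.ofReal (Real.exp (-m) * ((q * m : ℝ) ^ n / n.factorial)) := by
    rw [expNeg_mul_natCast, hq, poissonMeasure_singleton, ← ENNReal.coe_pow,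
      ← ENNReal.ofReal_coe_nnreal, ← ENNReal.ofReal_mul (by positivity)]
    congr 1
    push_cast
    ring
  simp only [h2]
  rw [← ENNReal.ofReal_tsum_of_nonneg (fun n => by positivity) hs.summable, hs.tsum_eq,
    ← Real.exp_add]
  congr 2
  ring

variable {Ω : Type*} [MeasurableSpace Ω]

lemma lintegral_expNeg_mul_pointCount {μ : Measure Ω} {lam : ℝ≥0} {X : ℕ → Ω → Plane}
    (hX : IsPoissonProcess μ lam X) {A : Set Plane} (hA : MeasurableSet A) (hA' : volume A ≠ ∞)
    (a : ℝ≥0∞) :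
    ∫⁻ ω, expNeg (a * pointCount X A ω) ∂μ = expNeg (lam * ((1 - expNeg a) * volume A)) := by
  have hl := hX.law A hA hA'
  have hm : Measurable fun x : ℝ≥0∞ => expNeg (a * x) := by fun_prop
  calc _ = ∫⁻ x, expNeg (a * x) ∂(μ.map (pointCount X A)) :=
        (lintegral_map' hm.aemeasurable hl.aemeasurable).symm
    _ = _ := by
        rw [hl.map_eq, lintegral_map hm (by fun_prop), lintegral_expNeg_poissonMeasure,
          ENNReal.coe_mul, ENNReal.coe_toNNReal hA']
        congr 1
        ring

/-- The Laplace functional of a Poisson process at a finite combination of indicators. -/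
lemma lintegral_expNeg_sum_mul_pointCount {μ : Measure Ω} [IsProbabilityMeasure μ] {lam : ℝ≥0}
    {X : ℕ → Ω → Plane} (hX : IsPoissonProcess μ lam X) {n : ℕ} {A : Fin n → Set Plane}
    (hA : ∀ i, MeasurableSet (A i)) (hA' : ∀ i, volume (A i) ≠ ∞)
    (hd : Pairwise fun i j => Disjoint (A i) (A j)) (a : Fin n → ℝ≥0∞) :
    ∫⁻ ω, expNeg (∑ i, a i * pointCount X (A i) ω) ∂μ
      = expNeg (lam * ∑ i, (1 - expNeg (a i)) * volume (A i)) := by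
  have hm (i : Fin n) : Measurable (pointCount X (A i)) := by
    unfold pointCount
    refine Measurable.tsum fun k => ?_
    exact (measurable_const.indicator (hA i)).comp (hX.measurable k)
  have hi : iIndepFun (fun i ω => expNeg (a i * pointCount X (A i) ω)) μ :=
    (hX.indep n A hA hA' hd).comp (fun i x => expNeg (a i * x)) fun i => by fun_prop
  simp only [expNeg_sum]
  rw [lintegral_prod_eq_prod_lintegral_of_indepFun _ _ hi fun i => by fun_prop,
    Finset.mul_sum, expNeg_sum]
  exact Finset.prod_congr rfl fun i _ => lintegral_expNeg_mul_pointCount hX (hA i) (hA' i) _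

/-- The level sets of φ partition the plane, so only the term with value φ x survives. The choice ψ
= id rewrites the sum over points, and ψ = 1 - `expNeg` the intensity integral. -/
lemma sum_range_mul_indicator (φ : SimpleFunc Plane ℝ≥0∞) (B : Set Plane) (ψ : ℝ≥0∞ → ℝ≥0∞)
    (x : Plane) :
    ∑ i : Fin φ.range.card, ψ (φ.range.equivFin.symm i) *
      (φ ⁻¹' {(φ.range.equivFin.symm i : ℝ≥0∞)} ∩ B).indicator (fun _ => 1) x
      = B.indicator (fun x => ψ (φ x)) x := by
  classical
  rw [Equiv.sum_comp φ.range.equivFin.symm (fun c => ψ (c : ℝ≥0∞) *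
    (φ ⁻¹' {(c : ℝ≥0∞)} ∩ B).indicator (fun _ => 1) x),
    Finset.sum_coe_sort φ.range (fun c => ψ c * (φ ⁻¹' {c} ∩ B).indicator (fun _ => 1) x),
    Finset.sum_eq_single (φ x)]
  · by_cases hx : x ∈ B <;> simp [hx, Set.indicator]
  · intro c _ hc
    simp [Set.indicator, hc.symm]
  · intro h
    exact absurd (φ.mem_range_self x) h

/-- The Laplace functional of a Poisson process at a simple function with bounded support. -/
lemma lintegral_expNeg_tsum_simpleFunc {μ : Measure Ω} [IsProbabilityMeasure μ] {lam : ℝ≥0}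
    {X : ℕ → Ω → Plane} (hX : IsPoissonProcess μ lam X) (φ : SimpleFunc Plane ℝ≥0∞)
    {B : Set Plane} (hB : MeasurableSet B) (hB' : volume B ≠ ∞) :
    ∫⁻ ω, expNeg (∑' k, B.indicator φ (X k ω)) ∂μ
      = expNeg (lam * ∫⁻ x, (1 - expNeg (B.indicator φ x))) := by
  set c : Fin φ.range.card → ℝ≥0∞ := fun i => φ.range.equivFin.symm i with hc
  set A : Fin φ.range.card → Set Plane := fun i => φ ⁻¹' {c i} ∩ B with hAdef
  have hA (i) : MeasurableSet (A i) := (φ.measurableSet_preimage _).inter hB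
  have hA' (i) : volume (A i) ≠ ∞ := measure_ne_top_of_subset Set.inter_subset_right hB'
  have hd : Pairwise fun i j => Disjoint (A i) (A j) := by
    intro i j hij
    refine Set.disjoint_left.2 fun x hi hj => hij ?_
    have : c i = c j := (hi.1 : φ x = c i).symm.trans hj.1
    exact φ.range.equivFin.symm.injective (Subtype.ext this)
  have h1 (ω : Ω) : ∑' k, B.indicator φ (X k ω) = ∑ i, c i * pointCount X (A i) ω := by
    simp only [pointCount, ← ENNReal.tsum_mul_left]
    rw [← Summable.tsum_finsetSum fun _ _ => ENNReal.summable]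
    exact tsum_congr fun k => (sum_range_mul_indicator φ B id (X k ω)).symm
  have h2 (x : Plane) : 1 - expNeg (B.indicator φ x)
      = ∑ i, (A i).indicator (fun _ => 1 - expNeg (c i)) x := by
    have := sum_range_mul_indicator φ B (fun y => 1 - expNeg y) x
    rw [show 1 - expNeg (B.indicator φ x) = B.indicator (fun x => 1 - expNeg (φ x)) x by
      by_cases hx : x ∈ B <;> simp [hx], ← this]
    refine Finset.sum_congr rfl fun i _ => ?_
    by_cases hx : x ∈ A i
    · rw [Set.indicator_of_mem hx]
      rw [Set.indicator_of_mem (show x ∈ φ ⁻¹' {(φ.range.equivFin.symm i : ℝ≥0∞)} ∩ B from hx),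
        mul_one]
    · rw [Set.indicator_of_notMem hx]
      rw [Set.indicator_of_notMem (show x ∉ φ ⁻¹' {(φ.range.equivFin.symm i : ℝ≥0∞)} ∩ B from hx),
        mul_zero]
  simp only [h1, h2]
  rw [lintegral_expNeg_sum_mul_pointCount hX hA hA' hd,
    lintegral_finsetSum _ fun i _ => measurable_const.indicator (hA i)]
  simp only [lintegral_indicator_const (hA _)]

/-- The Laplace functional of a homogeneous Poisson process. -/
theorem IsPoissonProcess.lintegral_expNeg_tsum {μ : Measure Ω} [IsProbabilityMeasure μ]
    {lam : ℝ≥0} {X : ℕ → Ω → Plane} (hX : IsPoissonProcess μ lam X) {u : Plane → ℝ≥0∞}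
    (hu : Measurable u) :
    ∫⁻ ω, expNeg (∑' k, u (X k ω)) ∂μ = expNeg (lam * ∫⁻ x, (1 - expNeg (u x))) := by
  -- Cutting off to balls keeps the level sets of finite volume, where the Poisson law of the counts
  -- is available.
  set v : ℕ → Plane → ℝ≥0∞ :=
    fun n => (Metric.ball (0 : Plane) n).indicator (SimpleFunc.eapprox u n) with hv
  have hvm (n : ℕ) : Measurable (v n) :=
    (SimpleFunc.eapprox u n).measurable.indicator measurableSet_ball
  have hmono (x : Plane) : Monotone fun n => v n x := by
    intro m n hmn
    have h1 : SimpleFunc.eapprox u m x ≤ SimpleFunc.eapprox u n x :=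
      SimpleFunc.monotone_eapprox u hmn x
    by_cases hx : x ∈ Metric.ball (0 : Plane) m
    · have hx' : x ∈ Metric.ball (0 : Plane) n :=
        Metric.ball_subset_ball (by exact_mod_cast hmn) hx
      simpa [hv, Set.indicator_of_mem hx, Set.indicator_of_mem hx'] using h1
    · simp [hv, Set.indicator_of_notMem hx]
  have htend (x : Plane) : Tendsto (fun n => v n x) atTop (𝓝 (u x)) := by
    have h1 : Tendsto (fun n => SimpleFunc.eapprox u n x) atTop (𝓝 (u x)) := by
      rw [← SimpleFunc.iSup_eapprox_apply hu x]
      exact tendsto_atTop_iSup fun m n hmn => SimpleFunc.monotone_eapprox u hmn x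
    refine h1.congr' ?_
    obtain ⟨N, hN⟩ := exists_nat_gt ‖x‖
    filter_upwards [eventually_ge_atTop N] with n hn
    have hx : x ∈ Metric.ball (0 : Plane) n := by
      rw [mem_ball_zero_iff]
      exact hN.trans_le (by exact_mod_cast hn)
    simp [hv, Set.indicator_of_mem hx]
  have hL : Tendsto (fun n => ∫⁻ ω, expNeg (∑' k, v n (X k ω)) ∂μ) atTop
      (𝓝 (∫⁻ ω, expNeg (∑' k, u (X k ω)) ∂μ)) := by
    refine tendsto_lintegral_expNeg (fun n => ?_) (ae_of_all _ fun ω => ?_)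
    · exact (Measurable.tsum fun k => (hvm n).comp (hX.measurable k)).aemeasurable
    -- The sum over points is an integral against counting measure, so monotone convergence applies
    -- for each ω.
    · simp only [← lintegral_count]
      exact lintegral_tendsto_of_tendsto_of_monotone
        (fun n => (measurable_of_countable _).aemeasurable)
        (ae_of_all _ fun k => hmono _) (ae_of_all _ fun k => htend _)
  have hR : Tendsto (fun n => expNeg (lam * ∫⁻ x, (1 - expNeg (v n x)))) atTop
      (𝓝 (expNeg (lam * ∫⁻ x, (1 - expNeg (u x))))) := by
    refine (continuous_expNeg.tendsto _).comp (ENNReal.Tendsto.const_mul ?_ (by simp))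
    refine lintegral_tendsto_of_tendsto_of_monotone (fun n => ?_) (ae_of_all _ fun x => ?_)
      (ae_of_all _ fun x => ?_)
    · exact (measurable_const.sub (measurable_expNeg.comp (hvm n))).aemeasurable
    · exact fun m n hmn => tsub_le_tsub_left (expNeg_antitone (hmono x hmn)) _
    · exact ENNReal.Tendsto.sub tendsto_const_nhds ((continuous_expNeg.tendsto _).comp (htend x))
        (by simp)
  refine tendsto_nhds_unique hL (hR.congr fun n => ?_)
  exact (lintegral_expNeg_tsum_simpleFunc hX _ measurableSet_ball measure_ball_lt_top.ne).symm

end RISNetwork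

/-! ### Laplace transforms of Gaussian powers -/

namespace RISNetwork

instance isProbabilityMeasure_complexNormal (v : ℝ≥0) : IsProbabilityMeasure (complexNormal v) :=
  Measure.isProbabilityMeasure_map (by
    refine Measurable.aemeasurable ?_
    exact Complex.measurableEquivRealProd.symm.measurable)

lemma lintegral_complexNormal (v : ℝ≥0) {φ : ℂ → ℝ≥0∞} (hφ : Measurable φ) :
    ∫⁻ z, φ z ∂(complexNormal v)
      = ∫⁻ z : ℝ × ℝ, φ ⟨z.1, z.2⟩ ∂((gaussianReal 0 (v / 2)).prod (gaussianReal 0 (v / 2))) :=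
  lintegral_map hφ Complex.measurableEquivRealProd.symm.measurable

/-- The Laplace transform of the square of a centred Gaussian variable. -/
lemma lintegral_exp_neg_mul_sq_gaussianReal (v : ℝ≥0) {s : ℝ} (hs : 0 ≤ s) :
    ∫⁻ x, ENNReal.ofReal (Real.exp (-(s * x ^ 2))) ∂(gaussianReal 0 v)
      = ENNReal.ofReal (√(1 + 2 * s * v))⁻¹ := by
  rcases eq_or_ne v 0 with rfl | hv
  · simp [gaussianReal_zero_var, lintegral_dirac]
  have hv' : (0 : ℝ) < v := NNReal.coe_pos.2 (pos_iff_ne_zero.2 hv)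
  have hint : Integrable (fun x : ℝ => Real.exp (-(s * x ^ 2))) (gaussianReal 0 v) := by
    refine Integrable.of_bound (by fun_prop) 1 (ae_of_all _ fun x => ?_)
    rw [Real.norm_eq_abs, abs_of_pos (Real.exp_pos _), Real.exp_le_one_iff]
    have := mul_nonneg hs (sq_nonneg x)
    linarith
  rw [← ofReal_integral_eq_lintegral_ofReal hint (ae_of_all _ fun x => (Real.exp_pos _).le),
    integral_gaussianReal_eq_integral_smul hv]
  congr 1
  have h1 (x : ℝ) : gaussianPDFReal 0 v x • Real.exp (-(s * x ^ 2))
      = (√(2 * Real.pi * v))⁻¹ * Real.exp (-(1 / (2 * v) + s) * x ^ 2) := by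
    rw [gaussianPDFReal, smul_eq_mul, mul_assoc, ← Real.exp_add]
    congr 2
    field_simp
    ring
  simp only [h1]
  rw [integral_const_mul, integral_gaussian, ← Real.sqrt_inv, ← Real.sqrt_inv,
    ← Real.sqrt_mul (by positivity)]
  congr 1
  field_simp

/-- The combination a x + b y of independent centred Gaussians is a centred Gaussian of variance a²
v + b² w, by the convolution formula, so the one-variable transform applies. -/
lemma lintegral_lintegral_exp_neg_mul_sq_gaussianReal (v w : ℝ≥0) (a b : ℝ) {s : ℝ}
    (hs : 0 ≤ s) :
    ∫⁻ x, ∫⁻ y, ENNReal.ofReal (Real.exp (-(s * (a * x + b * y) ^ 2)))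
      ∂(gaussianReal 0 w) ∂(gaussianReal 0 v)
      = ENNReal.ofReal (√(1 + 2 * s * (a ^ 2 * v + b ^ 2 * w)))⁻¹ := by
  have hc := gaussianReal_conv_gaussianReal (m₁ := 0) (m₂ := 0)
    (v₁ := .mk (a ^ 2) (sq_nonneg a) * v) (v₂ := .mk (b ^ 2) (sq_nonneg b) * w)
  have ha : (gaussianReal 0 v).map (a * ·) = _ := gaussianReal_map_const_mul a
  have hb : (gaussianReal 0 w).map (b * ·) = _ := gaussianReal_map_const_mul b
  rw [mul_zero] at ha hb
  rw [← ha, ← hb, add_zero] at hc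
  have h := lintegral_exp_neg_mul_sq_gaussianReal
    (.mk (a ^ 2) (sq_nonneg a) * v + .mk (b ^ 2) (sq_nonneg b) * w) hs
  rw [← hc, Measure.lintegral_conv (by fun_prop), lintegral_map (by fun_prop) (by fun_prop)] at h
  have hx (x : ℝ) : ∫⁻ y, ENNReal.ofReal (Real.exp (-(s * (a * x + y) ^ 2)))
      ∂((gaussianReal 0 w).map (b * ·))
      = ∫⁻ y, ENNReal.ofReal (Real.exp (-(s * (a * x + b * y) ^ 2))) ∂(gaussianReal 0 w) :=
    lintegral_map (by fun_prop) (by fun_prop)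
  simp only [hx] at h
  exact h

/-- The Laplace transform of the power of a combination of two independent complex normal
variables. -/
theorem lintegral_exp_neg_mul_norm_sq_complexNormal (v w : ℝ≥0) (a b : ℝ) {s : ℝ}
    (hs : 0 ≤ s) :
    ∫⁻ z, ENNReal.ofReal (Real.exp (-(s * ‖(a : ℂ) * z.1 + (b : ℂ) * z.2‖ ^ 2)))
      ∂((complexNormal v).prod (complexNormal w))
      = ENNReal.ofReal (1 + s * (a ^ 2 * v + b ^ 2 * w))⁻¹ := by
  set φ : ℝ → ℝ≥0∞ := fun x => ENNReal.ofReal (Real.exp (-(s * x ^ 2))) with hφ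
  have hφm : Measurable φ := by fun_prop
  -- The coefficients are real, so the squared modulus separates into real and imaginary parts.
  -- These are independent with the same law, and the product of their two inverse square roots is
  -- the inverse itself.
  have hsplit (x y x' y' : ℝ) :
      ENNReal.ofReal (Real.exp (-(s * ‖(a : ℂ) * ⟨x, y⟩ + (b : ℂ) * ⟨x', y'⟩‖ ^ 2)))
        = φ (a * x + b * x') * φ (a * y + b * y') := by
    rw [hφ, ← ENNReal.ofReal_mul (Real.exp_pos _).le, ← Real.exp_add, Complex.sq_norm,
      Complex.normSq_apply]
    congr 2
    simp
    ring
  rw [lintegral_prod _ (by fun_prop), lintegral_complexNormal _ (by fun_prop)]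
  have h0 (z : ℂ) : ∫⁻ z', ENNReal.ofReal (Real.exp
      (-(s * ‖(a : ℂ) * z + (b : ℂ) * z'‖ ^ 2))) ∂(complexNormal w) = _ :=
    lintegral_complexNormal w (by fun_prop)
  simp only [h0]
  simp only [hsplit]
  have h1 (x y : ℝ) : ∫⁻ z : ℝ × ℝ, φ (a * x + b * z.1) * φ (a * y + b * z.2)
      ∂((gaussianReal 0 (w / 2)).prod (gaussianReal 0 (w / 2)))
      = (∫⁻ t, φ (a * x + b * t) ∂(gaussianReal 0 (w / 2)))
        * ∫⁻ t, φ (a * y + b * t) ∂(gaussianReal 0 (w / 2)) :=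
    lintegral_prod_mul (f := fun t => φ (a * x + b * t)) (g := fun t => φ (a * y + b * t))
      (by fun_prop) (by fun_prop)
  simp_rw [h1]
  have hm : Measurable fun x => ∫⁻ t, φ (a * x + b * t) ∂(gaussianReal 0 (w / 2)) :=
    Measurable.lintegral_prod_right' (f := fun z : ℝ × ℝ => φ (a * z.1 + b * z.2)) (by fun_prop)
  rw [lintegral_prod_mul hm.aemeasurable hm.aemeasurable,
    lintegral_lintegral_exp_neg_mul_sq_gaussianReal _ _ _ _ hs,
    ← ENNReal.ofReal_mul (by positivity),
    ← mul_inv, Real.mul_self_sqrt (by positivity)]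
  congr 2
  push_cast
  ring

end RISNetwork

/-! ### An integral representation of the hypergeometric function -/

namespace RISNetwork

open Filter Topology Set

/-- The integrand of an integral representation of `₂F₁(1, -2/α; 1 - 2/α; ·)`. -/
noncomputable def hypKernel (α : ℝ) (z : ℂ) (r : ℝ) : ℂ :=
  z / (1 - z * (r ^ (-α) : ℝ)) * (r ^ (1 - α) : ℝ)

lemma rpow_neg_mem_Ioc {α r : ℝ} (hα : 2 < α) (hr : 1 < r) : r ^ (-α) ∈ Ioc (0 : ℝ) 1 :=
  ⟨Real.rpow_pos_of_pos (by linarith) _,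
    Real.rpow_le_one_of_one_le_of_nonpos hr.le (by linarith)⟩

/-- The real part 1 - q Re z is already this large. The bound is uniform in q, which supplies the
dominating functions on the half-plane Re z < 1. -/
lemma min_le_norm_one_sub_mul {z : ℂ} {q : ℝ} (hq : q ∈ Ioc (0 : ℝ) 1) :
    min 1 (1 - z.re) ≤ ‖1 - z * (q : ℂ)‖ := by
  refine le_trans ?_ (Complex.re_le_norm _)
  simp only [Complex.sub_re, Complex.one_re, Complex.re_mul_ofReal]
  rcases le_total 0 z.re with h | h
  · refine (min_le_right _ _).trans ?_
    nlinarith [hq.1, hq.2]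
  · refine (min_le_left _ _).trans ?_
    nlinarith [hq.1, hq.2]

lemma one_sub_mul_ne_zero {z : ℂ} (hz : z.re < 1) {q : ℝ} (hq : q ∈ Ioc (0 : ℝ) 1) :
    1 - z * (q : ℂ) ≠ 0 := by
  rw [← norm_pos_iff]
  exact (lt_min one_pos (sub_pos.2 hz)).trans_le (min_le_norm_one_sub_mul hq)

lemma integrableOn_rpow_one_sub {α : ℝ} (hα : 2 < α) :
    IntegrableOn (fun r : ℝ => r ^ (1 - α)) (Ioi 1) :=
  integrableOn_Ioi_rpow_of_lt (by linarith) one_pos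

lemma integrable_hypKernel {α : ℝ} (hα : 2 < α) {z : ℂ} (hz : z.re < 1) :
    IntegrableOn (hypKernel α z) (Ioi 1) := by
  have hm : 0 < min 1 (1 - z.re) := lt_min one_pos (sub_pos.2 hz)
  refine ((integrableOn_rpow_one_sub hα).const_mul (‖z‖ / min 1 (1 - z.re))).mono'
    (by unfold hypKernel; fun_prop) ?_
  filter_upwards [ae_restrict_mem measurableSet_Ioi] with r hr
  have hr1 : (1 : ℝ) < r := hr
  rw [hypKernel, norm_mul, norm_div, Complex.norm_real,
    Real.norm_of_nonneg (Real.rpow_nonneg (by linarith) _)]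
  gcongr
  exact min_le_norm_one_sub_mul (rpow_neg_mem_Ioc hα hr)

lemma hasDerivAt_integral_hypKernel {α : ℝ} (hα : 2 < α) {z₀ : ℂ} (hz₀ : z₀.re < 1) :
    HasDerivAt (fun z => ∫ r in Ioi 1, hypKernel α z r)
      (∫ r in Ioi 1, 1 / (1 - z₀ * (r ^ (-α) : ℝ)) ^ 2 * ((r ^ (1 - α) : ℝ) : ℂ)) z₀ := by
  set ε : ℝ := (1 - z₀.re) / 2 with hε
  have hε0 : 0 < ε := by linarith
  have hs : {z : ℂ | z.re < 1 - ε} ∈ 𝓝 z₀ :=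
    (isOpen_lt Complex.continuous_re continuous_const).mem_nhds (by simp; linarith)
  have hm : 0 < min 1 ε := lt_min one_pos hε0
  refine (hasDerivAt_integral_of_dominated_loc_of_deriv_le (F := fun z r => hypKernel α z r)
    (F' := fun z r => 1 / (1 - z * (r ^ (-α) : ℝ)) ^ 2 * ((r ^ (1 - α) : ℝ) : ℂ))
    (bound := fun r => 1 / (min 1 ε) ^ 2 * r ^ (1 - α)) hs
    (Eventually.of_forall fun z => by unfold hypKernel; fun_prop)
    (integrable_hypKernel hα hz₀) (by fun_prop) ?_
    ((integrableOn_rpow_one_sub hα).const_mul _) ?_).2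
  · filter_upwards [ae_restrict_mem measurableSet_Ioi] with r hr z hz
    have hr1 : (1 : ℝ) < r := hr
    have hz' : z.re < 1 - ε := hz
    rw [norm_mul, norm_div, Complex.norm_real, norm_pow, norm_one,
      Real.norm_of_nonneg (Real.rpow_nonneg (by linarith) _)]
    gcongr
    refine le_trans ?_ (min_le_norm_one_sub_mul (rpow_neg_mem_Ioc hα hr))
    exact min_le_min_left _ (by linarith)
  · filter_upwards [ae_restrict_mem measurableSet_Ioi] with r hr z hz
    have hz' : z.re < 1 - ε := hz
    have hne := one_sub_mul_ne_zero (z := z) (by linarith) (rpow_neg_mem_Ioc hα hr)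
    have h1 : HasDerivAt (fun z : ℂ => 1 - z * ((r ^ (-α) : ℝ) : ℂ)) (-((r ^ (-α) : ℝ) : ℂ)) z := by
      simpa using ((hasDerivAt_id z).mul_const ((r ^ (-α) : ℝ) : ℂ)).const_sub 1
    have h2 := ((hasDerivAt_id z).div h1 hne).mul_const ((r ^ (1 - α) : ℝ) : ℂ)
    refine h2.congr_deriv ?_
    simp

/-- An integral representation of `₂F₁(1, -2/α; 1 - 2/α; x)` for `x < 1`. -/
noncomputable def hypIntegral (α x : ℝ) : ℝ :=
  1 - 2 * ∫ r in Ioi (1 : ℝ), x / (1 - x * r ^ (-α)) * r ^ (1 - α)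

lemma re_integral_hypKernel (α x : ℝ) :
    (∫ r in Ioi 1, hypKernel α x r).re
      = ∫ r in Ioi (1 : ℝ), x / (1 - x * r ^ (-α)) * r ^ (1 - α) := by
  rw [← Complex.ofReal_re (∫ r in Ioi (1 : ℝ), x / (1 - x * r ^ (-α)) * r ^ (1 - α)),
    ← integral_complex_ofReal]
  congr 2
  ext r
  simp [hypKernel]

/-- The complex integral is holomorphic on Re z < 1, hence analytic there, and the real part of its
restriction to the real axis is real analytic. -/
lemma analyticOnNhd_hypIntegral {α : ℝ} (hα : 2 < α) :
    AnalyticOnNhd ℝ (hypIntegral α) (Iio 1) := by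
  intro x hx
  have ho : IsOpen {z : ℂ | z.re < 1} := isOpen_lt Complex.continuous_re continuous_const
  have hd : DifferentiableOn ℂ (fun z => ∫ r in Ioi 1, hypKernel α z r) {z : ℂ | z.re < 1} :=
    fun z hz => (hasDerivAt_integral_hypKernel hα hz).differentiableAt.differentiableWithinAt
  have ha := (hd.analyticOnNhd ho (x : ℂ) (by simpa using hx)).re_ofReal
  simp only [re_integral_hypKernel] at ha
  exact analyticAt_const.sub (analyticAt_const.mul ha)

lemma integral_rpow_neg_pow_mul {α : ℝ} (hα : 2 < α) (n : ℕ) :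
    IntegrableOn (fun r : ℝ => (r ^ (-α)) ^ n * r ^ (1 - α)) (Ioi 1) ∧
    ∫ r in Ioi (1 : ℝ), (r ^ (-α)) ^ n * r ^ (1 - α) = 1 / (α * (n + 1) - 2) := by
  have h (r : ℝ) (hr : r ∈ Ioi (1 : ℝ)) :
      (r ^ (-α)) ^ n * r ^ (1 - α) = r ^ (1 - α * (n + 1)) := by
    have hr0 : 0 < r := one_pos.trans hr
    rw [← Real.rpow_mul_natCast hr0.le, ← Real.rpow_add hr0]
    congr 1
    ring
  have hn : (0 : ℝ) ≤ n := n.cast_nonneg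
  have he : 1 - α * (n + 1) < -1 := by nlinarith
  constructor
  · exact (integrableOn_Ioi_rpow_of_lt he one_pos).congr_fun (fun r hr => (h r hr).symm)
      measurableSet_Ioi
  · rw [setIntegral_congr_fun measurableSet_Ioi h, integral_Ioi_rpow_of_lt he one_pos,
      Real.one_rpow, ← neg_div_neg_eq]
    congr 1 <;> ring

/-- Expand 1/(1 - x r^{-α}) as a geometric series and integrate term by term; the L¹ norms are at
most |x|^n / (α - 2). -/
lemma hasSum_hypIntegral {α : ℝ} (hα : 2 < α) {x : ℝ} (hx : x ∈ Ioo (-1 : ℝ) 1) :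
    HasSum (fun n : ℕ => x ^ (n + 1) * (1 / (α * (n + 1) - 2)))
      (∫ r in Ioi (1 : ℝ), x / (1 - x * r ^ (-α)) * r ^ (1 - α)) := by
  have hx' : |x| < 1 := abs_lt.2 hx
  have hα' (n : ℕ) : α - 2 ≤ α * (n + 1) - 2 := by
    have hn : (0 : ℝ) ≤ n := n.cast_nonneg
    nlinarith
  have hs := hasSum_integral_of_summable_integral_norm (μ := volume.restrict (Ioi (1 : ℝ)))
    (F := fun (n : ℕ) r => x ^ (n + 1) * ((r ^ (-α)) ^ n * r ^ (1 - α)))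
    (fun n => (integral_rpow_neg_pow_mul hα n).1.const_mul _) ?_
  · simp only [integral_const_mul, (integral_rpow_neg_pow_mul hα _).2] at hs
    rw [setIntegral_congr_fun measurableSet_Ioi fun r (hr : 1 < r) => ?_]
    · exact hs
    have hq := rpow_neg_mem_Ioc hα hr
    have hxq : ‖x * r ^ (-α)‖ < 1 := by
      rw [norm_mul, Real.norm_of_nonneg hq.1.le, Real.norm_eq_abs]
      exact (mul_le_of_le_one_right (abs_nonneg x) hq.2).trans_lt hx'
    have hg := ((hasSum_geometric_of_norm_lt_one hxq).mul_left (x * r ^ (1 - α))).tsum_eq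
    rw [div_mul_eq_mul_div, div_eq_mul_inv, ← hg]
    refine tsum_congr fun n => ?_
    ring
  · refine Summable.of_nonneg_of_le (fun n => integral_nonneg fun r => norm_nonneg _) (fun n => ?_)
      ((summable_geometric_of_abs_lt_one (r := |x|) (by rwa [abs_abs])).mul_right (1 / (α - 2)))
    have h1 : ∫ r in Ioi (1 : ℝ), ‖x ^ (n + 1) * ((r ^ (-α)) ^ n * r ^ (1 - α))‖
        = |x| ^ (n + 1) * (1 / (α * (n + 1) - 2)) := by
      rw [← (integral_rpow_neg_pow_mul hα n).2, ← integral_const_mul]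
      refine setIntegral_congr_fun measurableSet_Ioi fun r hr => ?_
      have hr0 : (0 : ℝ) ≤ r := (one_pos.trans hr).le
      have : (0 : ℝ) ≤ (r ^ (-α)) ^ n * r ^ (1 - α) := by positivity
      simp only [norm_mul, norm_pow, Real.norm_eq_abs] at this ⊢
      rw [abs_of_nonneg (Real.rpow_nonneg hr0 _), abs_of_nonneg (Real.rpow_nonneg hr0 _)]
    rw [h1]
    have : 0 < α - 2 := by linarith
    have h2 : 0 ≤ 1 / (α * (n + 1) - 2) := one_div_nonneg.2 (this.le.trans (hα' n))
    gcongr ?_ * (1 / ?_)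
    · exact pow_le_pow_of_le_one (abs_nonneg x) hx'.le n.le_succ
    · exact hα' n

/-- The coefficients of the hypergeometric series with parameters `1, b; b + 1`. -/
lemma hypergeometric_coefficient_one {b : ℝ} (hb : -1 < b) (hb0 : b < 0) (n : ℕ) :
    (n.factorial : ℝ)⁻¹ * (ascPochhammer ℝ n).eval 1 * (ascPochhammer ℝ n).eval b *
      ((ascPochhammer ℝ n).eval (1 + b))⁻¹ = b / (b + n) := by
  have h1 : (ascPochhammer ℝ n).eval b * (b + n) = b * (ascPochhammer ℝ n).eval (1 + b) := by
    rw [← ascPochhammer_succ_eval, ascPochhammer_succ_left]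
    simp [add_comm]
  have h2 : (ascPochhammer ℝ n).eval (1 + b) ≠ 0 := (ascPochhammer_pos n _ (by linarith)).ne'
  have h3 : b + n ≠ 0 := by
    rcases Nat.eq_zero_or_pos n with rfl | hn
    · simpa using hb0.ne
    · have : (1 : ℝ) ≤ n := by exact_mod_cast hn
      linarith
  rw [ascPochhammer_eval_one, inv_mul_cancel₀ (by positivity), one_mul]
  field_simp
  linarith

/-- With b = -2/α the coefficients are b/(b + n). The term n = 0 is the constant 1, and the term n +
1 has coefficient -2/(α(n+1) - 2), which is what the radial moments give. -/
theorem isHypContinuation_hypIntegral {α : ℝ} (hα : 2 < α) :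
    IsHypContinuation 1 (-(2 / α)) (1 - 2 / α) (hypIntegral α) := by
  refine ⟨analyticOnNhd_hypIntegral hα, fun x hx => ?_⟩
  have hα0 : 0 < α := by linarith
  have hb : -1 < -(2 / α) := by rw [neg_lt_neg_iff, div_lt_one hα0]; exact hα
  have hb0 : -(2 / α) < 0 := neg_neg_of_pos (by positivity)
  have hs := (hasSum_hypIntegral hα hx).mul_left (-2)
  have hs' : HasSum (fun n : ℕ => -(2 / α) / (-(2 / α) + n) * x ^ n) (hypIntegral α x) := by
    rw [← hasSum_nat_add_iff' 1]
    have he : hypIntegral α x - ∑ n ∈ Finset.range 1, -(2 / α) / (-(2 / α) + n) * x ^ n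
        = -2 * ∫ r in Ioi (1 : ℝ), x / (1 - x * r ^ (-α)) * r ^ (1 - α) := by
      have : 2 / α ≠ 0 := by positivity
      simp [hypIntegral, this]
    rw [he]
    refine hs.congr_fun fun n => ?_
    have hn : (0 : ℝ) ≤ n := n.cast_nonneg
    have h1 : α * (n + 1) - 2 ≠ 0 := by nlinarith
    have h2 : -(2 / α) + ((n + 1 : ℕ) : ℝ) ≠ 0 := by push_cast; linarith
    have h3 : -(2 / α) + ((n + 1 : ℕ) : ℝ) = (α * (n + 1) - 2) / α := by
      push_cast; field_simp; ring
    rw [h3]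
    field_simp
  rw [ordinaryHypergeometric_eq_tsum, ← hs'.tsum_eq]
  refine tsum_congr fun n => ?_
  rw [sub_eq_add_neg, hypergeometric_coefficient_one hb hb0, smul_eq_mul]

/-- Radial integrals of `1 - (1 + c r⁻ᵅ)⁻¹` in terms of the hypergeometric function. -/
theorem integral_Ioi_eq_hyp2F1 {α : ℝ} (hα : 2 < α) {c d : ℝ} (hc : 0 ≤ c) (hd : 0 < d) :
    2 * ∫ r in Ioi d, r * (1 - (1 + c * r ^ (-α))⁻¹)
      = d ^ 2 * (hyp2F1 1 (-(2 / α)) (1 - 2 / α) (-(c * d ^ (-α))) - 1) := by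
  have hcd : 0 ≤ c * d ^ (-α) := by positivity
  rw [hyp2F1_eq (isHypContinuation_hypIntegral hα) (by linarith), hypIntegral]
  -- The dilation r ↦ d r moves the domain to (1, ∞) and turns c into c d^{-α}.
  have h := integral_comp_mul_left_Ioi (fun r => r * (1 - (1 + c * r ^ (-α))⁻¹)) 1 hd
  rw [mul_one, smul_eq_mul, eq_inv_mul_iff_mul_eq₀ hd.ne'] at h
  rw [← h]
  have h2 : ∫ r in Ioi (1 : ℝ), d * r * (1 - (1 + c * (d * r) ^ (-α))⁻¹)
      = -d * ∫ r in Ioi (1 : ℝ),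
        -(c * d ^ (-α)) / (1 - -(c * d ^ (-α)) * r ^ (-α)) * r ^ (1 - α) := by
    rw [← integral_const_mul]
    refine setIntegral_congr_fun measurableSet_Ioi fun r hr => ?_
    have hr0 : 0 < r := one_pos.trans hr
    have h1 : 0 < 1 + c * d ^ (-α) * r ^ (-α) := by positivity
    rw [Real.mul_rpow hd.le hr0.le, sub_eq_add_neg 1 α, Real.rpow_add hr0, Real.rpow_one,
      ← mul_assoc c, neg_mul (c * d ^ (-α)), sub_neg_eq_add]
    field_simp
    ring
  rw [h2]
  ring

end RISNetwork

/-! ### Radial profiles and Poisson functionals on empty discs -/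

namespace RISNetwork

open Filter Topology Set

/-- A finite measure on `(0, ∞)` with a differentiable tail function has a density. -/
lemma eq_withDensity_of_hasDerivAt {κ : Measure ℝ} [IsFiniteMeasure κ] (hκ : κ (Iic 0) = 0)
    {G g : ℝ → ℝ} (hG : ∀ a, 0 ≤ a → κ (Ioi a) = ENNReal.ofReal (G a)) (hGc : Continuous G)
    (hGd : ∀ a, 0 < a → HasDerivAt G (-g a) a) (hg : ∀ a, 0 < a → 0 ≤ g a)
    (hGt : Tendsto G atTop (𝓝 0)) :
    κ = (volume.restrict (Ioi 0)).withDensity fun a => ENNReal.ofReal (g a) := by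
  set ν := (volume.restrict (Ioi (0 : ℝ))).withDensity fun a => ENNReal.ofReal (g a) with hν
  have hνG (a : ℝ) (ha : 0 ≤ a) : ν (Ioi a) = ENNReal.ofReal (G a) := by
    have hd : ∀ x ∈ Ioi a, HasDerivAt G (-g x) x := fun x hx => hGd x (ha.trans_lt hx)
    have hneg : ∀ x ∈ Ioi a, -g x ≤ 0 := fun x hx => neg_nonpos.2 (hg x (ha.trans_lt hx))
    have hi := integrableOn_Ioi_deriv_of_nonpos hGc.continuousWithinAt hd hneg hGt
    have h := integral_Ioi_of_hasDerivAt_of_nonpos hGc.continuousWithinAt hd hneg hGt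
    rw [integral_neg, zero_sub, neg_inj] at h
    rw [hν, withDensity_apply _ measurableSet_Ioi, Measure.restrict_restrict measurableSet_Ioi,
      inter_eq_left.2 (Ioi_subset_Ioi ha), ← h, ofReal_integral_eq_lintegral_ofReal]
    · have hi' : IntegrableOn g (Ioi a) := by simpa using hi.neg
      exact hi'
    · filter_upwards [ae_restrict_mem measurableSet_Ioi] with x hx using hg x (ha.trans_lt hx)
  have hν0 : ν (Iic 0) = 0 := by
    rw [hν, withDensity_apply _ measurableSet_Iic, Measure.restrict_restrict measurableSet_Iic,
      inter_comm, Ioi_inter_Iic, Ioc_self, Measure.restrict_empty, lintegral_zero_measure]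
  have hsplit (ξ : Measure ℝ) (hξ : ξ (Iic 0) = 0) (s : Set ℝ) : ξ s = ξ (s ∩ Ioi 0) := by
    refine le_antisymm ?_ (measure_mono inter_subset_left)
    calc ξ s ≤ ξ (s ∩ Ioi 0 ∪ Iic 0) := measure_mono fun x hx => by
            rcases le_or_gt x 0 with h | h
            · exact Or.inr h
            · exact Or.inl ⟨hx, h⟩
      _ ≤ ξ (s ∩ Ioi 0) + ξ (Iic 0) := measure_union_le _ _
      _ = _ := by rw [hξ, add_zero]
  -- Finite measures agreeing on open right rays and in total mass are equal; as both vanish on (-∞,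
  -- 0], rays from a ≥ 0 suffice.
  refine ext_of_generate_finite (range Ioi)
    ((BorelSpace.measurable_eq (α := ℝ)).trans (borel_eq_generateFrom_Ioi ℝ))
    isPiSystem_Ioi ?_ ?_
  · rintro _ ⟨a, rfl⟩
    rw [hsplit κ hκ, hsplit ν hν0, Ioi_inter_Ioi, hG _ (le_max_right _ _),
      hνG _ (le_max_right _ _)]
  · rw [hsplit κ hκ, hsplit ν hν0, univ_inter, hG 0 le_rfl, hνG 0 le_rfl]

/-- Functions `v` on `(0, ∞)` with values in `(0, 1]` such that `x ↦ 1 - v ‖x‖` is integrable on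
the plane. -/
structure IsRadialProfile (v : ℝ → ℝ) : Prop where
  pos : ∀ r, 0 ≤ r → 0 < v r
  le_one : ∀ r, 0 ≤ r → v r ≤ 1
  measurable : Measurable v
  continuousOn : ContinuousOn v (Ioi 0)
  integrableOn : IntegrableOn (fun r => r * (1 - v r)) (Ioi 0)

/-- The radial integral of `1 - v` outside of the disc of radius `a`. -/
noncomputable def radialTail (v : ℝ → ℝ) (a : ℝ) : ℝ :=
  ∫ r in Ioi a, (Ioi 0).indicator (fun r => r * (1 - v r)) r

lemma radialTail_of_nonneg (v : ℝ → ℝ) {a : ℝ} (ha : 0 ≤ a) :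
    radialTail v a = ∫ r in Ioi a, r * (1 - v r) :=
  setIntegral_congr_fun measurableSet_Ioi fun _ hr => indicator_of_mem (ha.trans_lt hr) _

lemma isRadialProfile_one : IsRadialProfile fun _ => 1 :=
  ⟨by simp, by simp, by fun_prop, by fun_prop, by simp⟩

lemma radialTail_one (a : ℝ) : radialTail (fun _ => 1) a = 0 := by
  simp [radialTail]

namespace IsRadialProfile

variable {v : ℝ → ℝ} (hv : IsRadialProfile v)
include hv

lemma radialTail_nonneg (a : ℝ) : 0 ≤ radialTail v a :=
  integral_nonneg fun r => indicator_nonneg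
    (fun r (hr : 0 < r) => mul_nonneg hr.le (sub_nonneg.2 (hv.le_one r hr.le))) r

lemma integrable_indicator :
    Integrable ((Ioi (0 : ℝ)).indicator fun r => r * (1 - v r)) :=
  (integrable_indicator_iff measurableSet_Ioi).2 hv.integrableOn

/-- The indicator in `radialTail` makes this valid for every real a, so continuity on the whole line
and the derivative at a > 0 both follow from the fundamental theorem of calculus. -/
lemma radialTail_eq_sub (a : ℝ) :
    radialTail v a = radialTail v 0
      - ∫ r in (0 : ℝ)..a, (Ioi 0).indicator (fun r => r * (1 - v r)) r := by
  rw [← intervalIntegral.integral_Ioi_sub_Ioi' hv.integrable_indicator.integrableOn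
    hv.integrable_indicator.integrableOn]
  simp [radialTail]

lemma continuous_radialTail : Continuous (radialTail v) := by
  rw [funext hv.radialTail_eq_sub]
  exact continuous_const.sub (intervalIntegral.continuous_primitive
    (fun a b => hv.integrable_indicator.intervalIntegrable) 0)

lemma hasDerivAt_radialTail {a : ℝ} (ha : 0 < a) :
    HasDerivAt (radialTail v) (-(a * (1 - v a))) a := by
  rw [funext hv.radialTail_eq_sub]
  have hn : Ioi (0 : ℝ) ∈ 𝓝 a := Ioi_mem_nhds ha
  have hc : ContinuousAt ((Ioi (0 : ℝ)).indicator fun r => r * (1 - v r)) a := by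
    have h1 : ContinuousAt (fun r => r * (1 - v r)) a :=
      continuousAt_id.mul (continuousAt_const.sub (hv.continuousOn.continuousAt hn))
    refine h1.congr ?_
    filter_upwards [hn] with r hr
    rw [indicator_of_mem hr]
  have h := intervalIntegral.integral_hasDerivAt_right
    (hv.integrable_indicator.intervalIntegrable (a := 0) (b := a))
    (hv.integrable_indicator.aestronglyMeasurable.stronglyMeasurableAtFilter) hc
  rw [indicator_of_mem (show a ∈ Ioi (0 : ℝ) from ha)] at h
  exact h.const_sub _

/-- The integral of `1 - v` outside of a disc, in polar coordinates. -/
lemma lintegral_compl_closedBall {a : ℝ} (ha : 0 ≤ a) :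
    ∫⁻ x : Plane in (Metric.closedBall 0 a)ᶜ, ENNReal.ofReal (1 - v ‖x‖)
      = ENNReal.ofReal (2 * Real.pi * radialTail v a) := by
  have hf : Module.finrank ℝ Plane = 2 := by simp
  set f : ℝ → ℝ := (Ioi a).indicator fun r => 1 - v r with hfdef
  have hf0 (r : ℝ) : 0 ≤ f r :=
    indicator_nonneg (fun r (hr : a < r) =>
      sub_nonneg.2 (hv.le_one r (ha.trans hr.le))) r
  have hmul (r : ℝ) : r ^ (Module.finrank ℝ Plane - 1) • f r
      = (Ioi a).indicator (fun r => r * (1 - v r)) r := by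
    rw [hf]
    by_cases hr : r ∈ Ioi a <;> simp [hfdef, indicator, hr]
  have hint : Integrable (fun x : Plane => f ‖x‖) := by
    rw [integrable_fun_norm_addHaar]
    simp only [hmul]
    exact hv.integrableOn.indicator measurableSet_Ioi
  have hI : ∫ x : Plane, f ‖x‖ = 2 * Real.pi * radialTail v a := by
    rw [integral_fun_norm_addHaar]
    simp only [hmul]
    rw [setIntegral_indicator measurableSet_Ioi, inter_eq_right.2 (Ioi_subset_Ioi ha), hf,
      radialTail_of_nonneg v ha, Measure.real, EuclideanSpace.volume_ball_fin_two]
    simp [mul_assoc, Real.pi_pos.le]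
  rw [← hI, ofReal_integral_eq_lintegral_ofReal hint (ae_of_all _ fun x => hf0 _),
    ← lintegral_indicator Metric.isClosed_closedBall.measurableSet.compl]
  refine lintegral_congr fun x => ?_
  by_cases hx : a < ‖x‖ <;> simp [hfdef, indicator, hx]

end IsRadialProfile

lemma expNeg_ofReal_neg_log {y : ℝ} (hy : 0 < y) (hy1 : y ≤ 1) :
    expNeg (ENNReal.ofReal (-Real.log y)) = ENNReal.ofReal y := by
  rw [expNeg_ofReal (neg_nonneg.2 (Real.log_nonpos hy.le hy1)), neg_neg, Real.exp_log hy]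

variable {Ω : Type*} [MeasurableSpace Ω] {μ : Measure Ω} [IsProbabilityMeasure μ] {lam : ℝ≥0}
  {X : ℕ → Ω → Plane}

/-- The probability generating functional of a Poisson process, restricted to the event that a
disc is empty. -/
lemma IsPoissonProcess.lintegral_indicator_expNeg (hX : IsPoissonProcess μ lam X) {v : ℝ → ℝ}
    (hv : IsRadialProfile v) {a : ℝ} (ha : 0 ≤ a) :
    ∫⁻ ω in {ω | ∀ k, a < ‖X k ω‖}, expNeg (∑' k, ENNReal.ofReal (-Real.log (v ‖X k ω‖))) ∂μ
      = ENNReal.ofReal (Real.exp (-(lam * (Real.pi * a ^ 2 + 2 * Real.pi * radialTail v a)))) := by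
  classical
  -- The value ∞ on the disc makes the exponential vanish as soon as one point falls in it, so u
  -- encodes both the empty-disc event and the product of v.
  set u : Plane → ℝ≥0∞ := fun x =>
    if ‖x‖ ≤ a then ∞ else ENNReal.ofReal (-Real.log (v ‖x‖)) with hu
  have hum : Measurable u :=
    Measurable.ite (measurableSet_le measurable_norm measurable_const) measurable_const
      ((Real.measurable_log.comp (hv.measurable.comp measurable_norm)).neg.ennreal_ofReal)
  have hS : MeasurableSet {ω | ∀ k, a < ‖X k ω‖} := by
    rw [ofPred_forall]
    exact MeasurableSet.iInter fun k => measurableSet_lt measurable_const (hX.measurable k).norm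
  have h1 (ω : Ω) : {ω | ∀ k, a < ‖X k ω‖}.indicator
      (fun ω => expNeg (∑' k, ENNReal.ofReal (-Real.log (v ‖X k ω‖)))) ω
      = expNeg (∑' k, u (X k ω)) := by
    by_cases h : ∀ k, a < ‖X k ω‖
    · rw [indicator_of_mem (show ω ∈ {ω | ∀ k, a < ‖X k ω‖} from h)]
      congr 2
      ext k
      exact (if_neg (not_le.2 (h k))).symm
    · rw [indicator_of_notMem (show ω ∉ {ω | ∀ k, a < ‖X k ω‖} from h)]
      push Not at h
      obtain ⟨k, hk⟩ := h
      rw [ENNReal.tsum_eq_top_of_eq_top ⟨k, if_pos hk⟩, expNeg_top]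
  rw [← lintegral_indicator hS]
  simp only [h1]
  have hB : MeasurableSet (Metric.closedBall (0 : Plane) a) :=
    Metric.isClosed_closedBall.measurableSet
  have h2 : ∫⁻ x, (1 - expNeg (u x))
      = ENNReal.ofReal (Real.pi * a ^ 2 + 2 * Real.pi * radialTail v a) := by
    have hpi := Real.pi_pos
    have ht := hv.radialTail_nonneg a
    rw [← lintegral_add_compl _ hB, ENNReal.ofReal_add (by positivity) (by positivity),
      ← hv.lintegral_compl_closedBall ha]
    congr 1
    · rw [setLIntegral_congr_fun (g := fun _ => 1) hB fun x hx => ?_]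
      · rw [setLIntegral_one, EuclideanSpace.volume_closedBall_fin_two,
          ENNReal.ofReal_mul Real.pi_pos.le, ENNReal.ofReal_pow ha, mul_comm]
      · have hx' : ‖x‖ ≤ a := by simpa using hx
        simp [hu, hx']
    · refine setLIntegral_congr_fun hB.compl fun x hx => ?_
      have hx' : ¬ ‖x‖ ≤ a := by simpa using hx
      simp only [hu, if_neg hx']
      rw [expNeg_ofReal_neg_log (hv.pos _ (norm_nonneg _)) (hv.le_one _ (norm_nonneg _)),
          ENNReal.ofReal_sub _ (hv.pos _ (norm_nonneg _)).le,
        ENNReal.ofReal_one]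
  rw [hX.lintegral_expNeg_tsum hum, h2, ← ENNReal.ofReal_coe_nnreal,
    ← ENNReal.ofReal_mul lam.coe_nonneg, expNeg_ofReal]
  have hpi := Real.pi_pos
  have ht := hv.radialTail_nonneg a
  positivity

end RISNetwork

/-! ### The nearest point and the process seen from it -/

namespace RISNetwork

open Filter Topology Set

variable {Ω : Type*} [MeasurableSpace Ω]

lemma measurable_servingIndex {X : ℕ → Ω → Plane} (hX : ∀ k, Measurable (X k)) :
    Measurable (servingIndex X) := by
  have hS (k : ℕ) : MeasurableSet {ω | ∀ j, ‖X k ω‖ ≤ ‖X j ω‖} := by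
    rw [ofPred_forall]
    exact MeasurableSet.iInter fun j => measurableSet_le (hX k).norm (hX j).norm
  refine measurable_to_nat fun ω₀ => ?_
  set n := servingIndex X ω₀
  -- The value 0 is also the default of `sInf` on the empty set, so its preimage contains the
  -- configurations without a nearest point.
  by_cases hn : n = 0
  · have h : servingIndex X ⁻¹' {n} = {ω | ∀ j, ‖X 0 ω‖ ≤ ‖X j ω‖} ∪
        ⋂ k, {ω | ∀ j, ‖X k ω‖ ≤ ‖X j ω‖}ᶜ := by
      ext ω
      simp only [mem_preimage, mem_singleton_iff, hn, servingIndex, Nat.sInf_eq_zero,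
        eq_empty_iff_forall_notMem, mem_union, mem_iInter, mem_compl_iff]
      rfl
    rw [h]
    exact (hS 0).union (MeasurableSet.iInter fun k => (hS k).compl)
  · have h : servingIndex X ⁻¹' {n} = {ω | ∀ j, ‖X n ω‖ ≤ ‖X j ω‖} ∩
        ⋂ k, ⋂ (_ : k < n), {ω | ∀ j, ‖X k ω‖ ≤ ‖X j ω‖}ᶜ := by
      ext ω
      simp only [mem_preimage, mem_singleton_iff, mem_inter_iff, mem_iInter, mem_compl_iff]
      constructor
      · intro h
        have hne : {k | ∀ j, ‖X k ω‖ ≤ ‖X j ω‖}.Nonempty :=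
          Nat.nonempty_of_pos_sInf (by rw [servingIndex] at h; omega)
        refine ⟨?_, fun k hk => ?_⟩
        · have := Nat.sInf_mem hne
          rw [← h]
          exact this
        · rw [← h] at hk
          exact Nat.notMem_of_lt_sInf hk
      · rintro ⟨h1, h2⟩
        refine le_antisymm (Nat.sInf_le h1) (not_lt.1 fun hlt => h2 _ hlt ?_)
        exact Nat.sInf_mem (s := {k | ∀ j, ‖X k ω‖ ≤ ‖X j ω‖}) ⟨n, h1⟩
    rw [h]
    exact (hS n).inter (MeasurableSet.iInter fun k => MeasurableSet.iInter fun _ => (hS k).compl)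

omit [MeasurableSpace Ω] in
lemma servingDist_nonneg (X : ℕ → Ω → Plane) (ω : Ω) : 0 ≤ servingDist X ω := norm_nonneg _

lemma measurable_servingDist {X : ℕ → Ω → Plane} (hX : ∀ k, Measurable (X k)) :
    Measurable (servingDist X) := by
  intro s hs
  have h : servingDist X ⁻¹' s
      = ⋃ n, servingIndex X ⁻¹' {n} ∩ (fun ω => ‖X n ω‖) ⁻¹' s := by
    ext ω
    simp [servingDist]
  rw [h]
  exact MeasurableSet.iUnion fun n =>
    (measurable_servingIndex hX (measurableSet_singleton n)).inter ((hX n).norm hs)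

variable {μ : Measure Ω} [IsProbabilityMeasure μ] {lam : ℝ≥0} {X : ℕ → Ω → Plane}

namespace IsPoissonProcess

variable (hX : IsPoissonProcess μ lam X)
include hX

omit [IsProbabilityMeasure μ] in
/-- Almost surely there is a nearest point. -/
lemma servingDist_le : ∀ᵐ ω ∂μ, ∀ j, servingDist X ω ≤ ‖X j ω‖ := by
  have hfin : ∀ᵐ ω ∂μ, ∀ n : ℕ, pointCount X (Metric.closedBall 0 n) ω ≠ ∞ := by
    refine ae_all_iff.2 fun n => ?_
    have hl := hX.law (Metric.closedBall 0 n) Metric.isClosed_closedBall.measurableSet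
      measure_closedBall_lt_top.ne
    have hs : MeasurableSet {x : ℝ≥0∞ | x ≠ ∞} := (measurableSet_singleton ∞).compl
    refine ae_of_ae_map hl.aemeasurable (p := fun x => x ≠ ∞) ?_
    rw [hl.map_eq, ae_map_iff (by fun_prop) hs]
    exact ae_of_all _ fun n => ENNReal.natCast_ne_top n
  filter_upwards [hfin] with ω hω
  -- A disc containing the point of index 0 holds finitely many points and at least one, so a
  -- minimum over it exists and is global.
  obtain ⟨n, hn⟩ := exists_nat_ge ‖X 0 ω‖
  have hS : {k | ‖X k ω‖ ≤ n}.Finite := by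
    refine (ENNReal.finite_const_le_of_tsum_ne_top (hω n) one_ne_zero).subset fun k hk => ?_
    have hk' : X k ω ∈ Metric.closedBall (0 : Plane) n := by simpa using hk
    simp [indicator_of_mem hk']
  obtain ⟨k, hk, hmin⟩ := exists_min_image _ (fun k => ‖X k ω‖) hS ⟨0, hn⟩
  have hmem : ∀ j, ‖X k ω‖ ≤ ‖X j ω‖ := fun j => by
    by_cases hj : ‖X j ω‖ ≤ n
    · exact hmin j hj
    · exact le_trans hk (not_le.1 hj).le
  exact Nat.sInf_mem (s := {k | ∀ j, ‖X k ω‖ ≤ ‖X j ω‖}) ⟨k, hmem⟩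

lemma setLIntegral_lt_servingDist {v : ℝ → ℝ} (hv : IsRadialProfile v) {a : ℝ} (ha : 0 ≤ a) :
    ∫⁻ ω in {ω | a < servingDist X ω},
        expNeg (∑' k, ENNReal.ofReal (-Real.log (v ‖X k ω‖))) ∂μ
      = ENNReal.ofReal (Real.exp (-(lam * (Real.pi * a ^ 2 + 2 * Real.pi * radialTail v a)))) := by
  rw [← hX.lintegral_indicator_expNeg hv ha]
  refine setLIntegral_congr ?_
  filter_upwards [hX.servingDist_le] with ω hω
  exact propext ⟨fun h k => lt_of_lt_of_le h (hω k), fun h => h _⟩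

/-- This is the void probability at radius 0: the profile v = 1 with a = 0 gives total mass e⁰ = 1.
-/
lemma servingDist_pos : ∀ᵐ ω ∂μ, 0 < servingDist X ω := by
  have h := hX.setLIntegral_lt_servingDist isRadialProfile_one le_rfl
  simp only [Real.log_one, neg_zero, ENNReal.ofReal_zero, tsum_zero, expNeg_zero,
    setLIntegral_one, radialTail_one] at h
  have hm : MeasurableSet {ω | 0 < servingDist X ω} :=
    measurableSet_lt measurable_const (measurable_servingDist hX.measurable)
  exact (prob_compl_eq_zero_iff hm).2 (by simpa using h)

/-- The law of the serving distance, weighted by a product over all points. -/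
lemma map_servingDist_withDensity (hlam : 0 < lam) {v : ℝ → ℝ} (hv : IsRadialProfile v) :
    (μ.withDensity fun ω => expNeg (∑' k, ENNReal.ofReal (-Real.log (v ‖X k ω‖)))).map
        (servingDist X)
      = (volume.restrict (Ioi 0)).withDensity fun a => ENNReal.ofReal
          (2 * Real.pi * lam * a * v a *
            Real.exp (-(lam * (Real.pi * a ^ 2 + 2 * Real.pi * radialTail v a)))) := by
  have hD := measurable_servingDist hX.measurable
  have hfin : IsFiniteMeasure
      (μ.withDensity fun ω => expNeg (∑' k, ENNReal.ofReal (-Real.log (v ‖X k ω‖)))) := by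
    refine isFiniteMeasure_withDensity ((lintegral_mono fun ω => expNeg_le_one _).trans_lt ?_).ne
    simp
  have hpi := Real.pi_pos
  have hlam' : (0 : ℝ) < lam := hlam
  refine eq_withDensity_of_hasDerivAt
    (G := fun a => Real.exp (-(lam * (Real.pi * a ^ 2 + 2 * Real.pi * radialTail v a))))
    ?_ (fun a ha => ?_) ?_ (fun a ha => ?_) (fun a ha => ?_) ?_
  · rw [Measure.map_apply hD measurableSet_Iic]
    refine withDensity_absolutelyContinuous _ _ ?_
    refine measure_mono_null ?_ hX.servingDist_pos
    intro ω hω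
    exact not_lt.2 (show servingDist X ω ≤ 0 from hω)
  · rw [Measure.map_apply hD measurableSet_Ioi, withDensity_apply _ (hD measurableSet_Ioi)]
    exact hX.setLIntegral_lt_servingDist hv ha
  · have := hv.continuous_radialTail
    fun_prop
  -- The derivative of πa² + 2πT(a) is 2πa - 2πa(1 - v(a)) = 2πa v(a), which is where the factor
  -- v(a) in the density comes from.
  · have h1 := (((hasDerivAt_pow 2 a).const_mul Real.pi).add
      ((hv.hasDerivAt_radialTail ha).const_mul (2 * Real.pi))).const_mul (lam : ℝ)
    refine h1.neg.exp.congr_deriv ?_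
    simp only [Pi.add_apply, Pi.neg_apply]
    push_cast
    ring
  · have := hv.pos a ha.le
    positivity
  · refine squeeze_zero (g := fun a : ℝ => Real.exp (-(lam * Real.pi * a ^ 2)))
      (fun a => (Real.exp_pos _).le) (fun a => ?_) ?_
    · have := mul_nonneg (mul_nonneg hlam'.le hpi.le) (hv.radialTail_nonneg a)
      exact Real.exp_le_exp.2 (by nlinarith)
    · exact Real.tendsto_exp_neg_atTop_nhds_zero.comp
        ((tendsto_pow_atTop two_ne_zero).const_mul_atTop (by positivity))

lemma map_servingDist (hlam : 0 < lam) :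
    μ.map (servingDist X) = (volume.restrict (Ioi 0)).withDensity fun a => ENNReal.ofReal
      (2 * Real.pi * lam * a * Real.exp (-(lam * (Real.pi * a ^ 2)))) := by
  simpa [radialTail_one] using hX.map_servingDist_withDensity hlam isRadialProfile_one

/-- Conditionally on the serving distance, the other points form a Poisson process outside of the
disc of that radius. -/
theorem lintegral_mul_expNeg_tsum_ite (hlam : 0 < lam) {v : ℝ → ℝ} (hv : IsRadialProfile v)
    {h : ℝ → ℝ≥0∞} (hh : Measurable h) :
    ∫⁻ ω, h (servingDist X ω) * expNeg (∑' k, if k = servingIndex X ω then 0 else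
        ENNReal.ofReal (-Real.log (v ‖X k ω‖))) ∂μ
      = ∫⁻ ω, h (servingDist X ω) * ENNReal.ofReal
          (Real.exp (-(lam * (2 * Real.pi * radialTail v (servingDist X ω))))) ∂μ := by
  have hD := measurable_servingDist hX.measurable
  have hvm := hv.measurable
  have hwm : Measurable fun ω => expNeg (∑' k, ENNReal.ofReal (-Real.log (v ‖X k ω‖))) := by
    refine measurable_expNeg.comp (Measurable.tsum fun k => ?_)
    have := hX.measurable k
    fun_prop
  have htm := hv.continuous_radialTail.measurable
  -- The product over the other points is the full product divided by the serving point's factor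
  -- v(D), which depends on D alone. The integral then only involves the weighted law of D.
  have hL (ω : Ω) : h (servingDist X ω) * expNeg (∑' k, if k = servingIndex X ω then 0 else
        ENNReal.ofReal (-Real.log (v ‖X k ω‖)))
      = expNeg (∑' k, ENNReal.ofReal (-Real.log (v ‖X k ω‖))) *
        (h (servingDist X ω) * (ENNReal.ofReal (v (servingDist X ω)))⁻¹) := by
    have hv0 : ENNReal.ofReal (v (servingDist X ω)) ≠ 0 :=
      (ENNReal.ofReal_pos.2 (hv.pos _ (norm_nonneg _))).ne'
    have hsum : ∑' k, ENNReal.ofReal (-Real.log (v ‖X k ω‖))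
        = ENNReal.ofReal (-Real.log (v (servingDist X ω))) + ∑' k, if k = servingIndex X ω then 0
          else ENNReal.ofReal (-Real.log (v ‖X k ω‖)) := by
      convert ENNReal.tsum_eq_add_tsum_ite (f := fun k => ENNReal.ofReal (-Real.log (v ‖X k ω‖)))
        (servingIndex X ω)
      rfl
    rw [hsum, expNeg_add, expNeg_ofReal_neg_log (hv.pos _ (servingDist_nonneg X ω))
      (hv.le_one _ (servingDist_nonneg X ω))]
    generalize expNeg (∑' k, if k = servingIndex X ω then 0 else
      ENNReal.ofReal (-Real.log (v ‖X k ω‖))) = T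
    calc _ = h (servingDist X ω) * T * (ENNReal.ofReal (v (servingDist X ω)) *
          (ENNReal.ofReal (v (servingDist X ω)))⁻¹) := by
          rw [ENNReal.mul_inv_cancel hv0 ENNReal.ofReal_ne_top, mul_one]
      _ = _ := by ring
  simp only [hL]
  calc _ = ∫⁻ r, h r * (ENNReal.ofReal (v r))⁻¹ ∂((μ.withDensity fun ω =>
          expNeg (∑' k, ENNReal.ofReal (-Real.log (v ‖X k ω‖)))).map (servingDist X)) := by
        rw [lintegral_map (by fun_prop) hD, lintegral_withDensity_eq_lintegral_mul _ hwm
          (by fun_prop)]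
        rfl
    _ = ∫⁻ r, h r * ENNReal.ofReal (Real.exp (-(lam * (2 * Real.pi * radialTail v r))))
          ∂(μ.map (servingDist X)) := by
        rw [hX.map_servingDist_withDensity hlam hv, hX.map_servingDist hlam,
          lintegral_withDensity_eq_lintegral_mul _ (by fun_prop) (by fun_prop),
          lintegral_withDensity_eq_lintegral_mul _ (by fun_prop) (by fun_prop)]
        refine setLIntegral_congr_fun measurableSet_Ioi fun r hr => ?_
        have hr0 : (0 : ℝ) < r := hr
        have hpi := Real.pi_pos
        have hv0 : ENNReal.ofReal (v r) ≠ 0 := by simpa using hv.pos _ hr0.le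
        have he : 2 * Real.pi * lam * r * v r *
            Real.exp (-(lam * (Real.pi * r ^ 2 + 2 * Real.pi * radialTail v r)))
            = v r * (2 * Real.pi * lam * r * Real.exp (-(lam * (Real.pi * r ^ 2))) *
              Real.exp (-(lam * (2 * Real.pi * radialTail v r)))) := by
          rw [mul_add, neg_add, Real.exp_add]
          ring
        simp only [Pi.mul_apply]
        rw [he, ENNReal.ofReal_mul (hv.pos r hr0.le).le, ENNReal.ofReal_mul (by positivity)]
        rw [mul_comm (ENNReal.ofReal (v r)), mul_assoc, mul_left_comm (ENNReal.ofReal (v r)),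
          ENNReal.mul_inv_cancel hv0 ENNReal.ofReal_ne_top, mul_one, mul_assoc,
          mul_comm (h r)]
    _ = _ := lintegral_map (by fun_prop) hD

end IsPoissonProcess

end RISNetwork

/-! ### Rayleigh profiles and the transform of one received power -/

namespace RISNetwork

open Filter Topology Set

/-! ### Radial profiles -/

/-- The Laplace transform `1 / (1 + c r⁻ᵅ)` of an exponential variable of mean `c r⁻ᵅ`. -/
noncomputable def rayleighProfile (α c r : ℝ) : ℝ := (1 + c * r ^ (-α))⁻¹

lemma one_sub_rayleighProfile_le {α c r : ℝ} (hc : 0 ≤ c) (hr : 0 ≤ r) :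
    1 - rayleighProfile α c r ≤ c * r ^ (-α) := by
  have hx : 0 ≤ c * r ^ (-α) := by positivity
  have h1 : 1 - rayleighProfile α c r = c * r ^ (-α) / (1 + c * r ^ (-α)) := by
    rw [rayleighProfile]
    field_simp
    ring
  rw [h1]
  exact div_le_self hx (by linarith)

/-- Near 0 the integrand is bounded; at infinity it is at most c r^{1-α}, integrable because α > 2.
At r = 0 the convention 0^{-α} = 0 gives the value 1, so continuity can only be expected on (0, ∞).
-/
lemma isRadialProfile_rayleighProfile {α c : ℝ} (hα : 2 < α) (hc : 0 ≤ c) :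
    IsRadialProfile (rayleighProfile α c) where
  pos r hr := by unfold rayleighProfile; positivity
  le_one r hr := by
    have hx : 0 ≤ c * r ^ (-α) := by positivity
    exact inv_le_one_of_one_le₀ (by linarith)
  measurable := by unfold rayleighProfile; fun_prop
  continuousOn := by
    refine ContinuousOn.inv₀ (continuousOn_const.add (continuousOn_const.mul ?_)) fun r hr => ?_
    · exact continuousOn_id.rpow_const fun r hr => Or.inl (ne_of_gt hr)
    · have hr0 : (0 : ℝ) < r := hr
      positivity
  integrableOn := by
    have hm : Measurable fun r => r * (1 - rayleighProfile α c r) := by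
      unfold rayleighProfile; fun_prop
    have hnn (r : ℝ) (hr : 0 < r) : 0 ≤ 1 - rayleighProfile α c r ∧
        1 - rayleighProfile α c r ≤ 1 := by
      have hx : 0 ≤ c * r ^ (-α) := by positivity
      have h1 : 0 ≤ rayleighProfile α c r := by unfold rayleighProfile; positivity
      exact ⟨sub_nonneg.2 (inv_le_one_of_one_le₀ (by linarith)), by linarith⟩
    rw [← Ioc_union_Ioi_eq_Ioi zero_le_one]
    refine IntegrableOn.union ?_ ?_
    · refine Measure.integrableOn_of_bounded (M := 1) (by simp) hm.aestronglyMeasurable ?_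
      filter_upwards [ae_restrict_mem measurableSet_Ioc] with r hr
      rw [Real.norm_of_nonneg (mul_nonneg hr.1.le (hnn r hr.1).1)]
      exact mul_le_one₀ hr.2 (hnn r hr.1).1 (hnn r hr.1).2
    · refine ((integrableOn_rpow_one_sub hα).const_mul c).mono' hm.aestronglyMeasurable ?_
      filter_upwards [ae_restrict_mem measurableSet_Ioi] with r hr
      have hr0 : (0 : ℝ) < r := one_pos.trans hr
      rw [Real.norm_of_nonneg (mul_nonneg hr0.le (hnn r hr0).1), sub_eq_add_neg 1 α,
        Real.rpow_add hr0, Real.rpow_one, mul_left_comm]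
      exact mul_le_mul_of_nonneg_left (one_sub_rayleighProfile_le hc hr0.le) hr0.le

/-- Radial profiles form a convex set. -/
lemma IsRadialProfile.convexComb {v w : ℝ → ℝ} (hv : IsRadialProfile v) (hw : IsRadialProfile w)
    {p : ℝ} (hp : p ∈ Icc (0 : ℝ) 1) :
    IsRadialProfile fun r => p * v r + (1 - p) * w r where
  pos r hr := convex_Ioi (0 : ℝ) (hv.pos r hr) (hw.pos r hr) hp.1 (sub_nonneg.2 hp.2) (by ring)
  le_one r hr :=
    convex_Iic (1 : ℝ) (hv.le_one r hr) (hw.le_one r hr) hp.1 (sub_nonneg.2 hp.2) (by ring)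
  measurable := by
    have := hv.measurable
    have := hw.measurable
    fun_prop
  continuousOn := (continuousOn_const.mul hv.continuousOn).add
    (continuousOn_const.mul hw.continuousOn)
  integrableOn := by
    refine ((hv.integrableOn.const_mul p).add (hw.integrableOn.const_mul (1 - p))).congr
      (ae_of_all _ fun r => ?_)
    simp only [Pi.add_apply]
    ring

/-- Linearity of the integral; this is why the conditional transform factorises over the two cluster
types. -/
lemma radialTail_convexComb {v w : ℝ → ℝ} (hv : IsRadialProfile v) (hw : IsRadialProfile w)
    {p a : ℝ} (ha : 0 ≤ a) :
    radialTail (fun r => p * v r + (1 - p) * w r) a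
      = p * radialTail v a + (1 - p) * radialTail w a := by
  have hs : Ioi a ⊆ Ioi 0 := Ioi_subset_Ioi ha
  rw [radialTail_of_nonneg _ ha, radialTail_of_nonneg _ ha, radialTail_of_nonneg _ ha,
    ← integral_const_mul, ← integral_const_mul,
    ← integral_add ((hv.integrableOn.mono_set hs).const_mul p)
      ((hw.integrableOn.mono_set hs).const_mul (1 - p))]
  congr 1
  ext r
  ring

lemma radialTail_rayleighProfile_le {α c d : ℝ} (hα : 2 < α) (hc : 0 ≤ c) (hd : 0 < d) :
    radialTail (rayleighProfile α c) d ≤ c * ∫ r in Ioi d, r ^ (1 - α) := by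
  rw [radialTail_of_nonneg _ hd.le, ← integral_const_mul]
  refine setIntegral_mono_on
    ((isRadialProfile_rayleighProfile hα hc).integrableOn.mono_set (Ioi_subset_Ioi hd.le))
    ((integrableOn_Ioi_rpow_of_lt (by linarith) hd).const_mul c) measurableSet_Ioi fun r hr => ?_
  have hr0 : 0 < r := hd.trans hr
  rw [sub_eq_add_neg 1 α, Real.rpow_add hr0, Real.rpow_one, mul_left_comm]
  exact mul_le_mul_of_nonneg_left (one_sub_rayleighProfile_le hc hr0.le) hr0.le

lemma two_mul_radialTail_rayleighProfile {α c d : ℝ} (hα : 2 < α) (hc : 0 ≤ c) (hd : 0 < d) :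
    2 * radialTail (rayleighProfile α c) d
      = d ^ 2 * (hyp2F1 1 (-(2 / α)) (1 - 2 / α) (-(c * d ^ (-α))) - 1) := by
  rw [radialTail_of_nonneg _ hd.le, ← integral_Ioi_eq_hyp2F1 hα hc hd]
  rfl

/-! ### The Laplace transform of the received power -/

instance isProbabilityMeasure_circleLaw (r : ℝ) : IsProbabilityMeasure (circleLaw r) := by
  have h : IsProbabilityMeasure ((ENNReal.ofReal (2 * Real.pi))⁻¹ •
      volume.restrict (Ioc (-Real.pi) Real.pi)) := ⟨by
    have hpi : ENNReal.ofReal (2 * Real.pi) ≠ 0 := by simp [Real.pi_pos]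
    rw [Measure.smul_apply, Measure.restrict_apply_univ, Real.volume_Ioc, smul_eq_mul,
      show Real.pi - -Real.pi = 2 * Real.pi by ring]
    exact ENNReal.inv_mul_cancel hpi ENNReal.ofReal_ne_top⟩
  refine Measure.isProbabilityMeasure_map (Continuous.aemeasurable ?_)
  fun_prop

instance sFinite_bernoulliLaw (p : ℝ) : SFinite (bernoulliLaw p) := by
  unfold bernoulliLaw
  infer_instance

lemma lintegral_bernoulliLaw (p : ℝ) (φ : Bool → ℝ≥0∞) :
    ∫⁻ b, φ b ∂(bernoulliLaw p)
      = ENNReal.ofReal p * φ true + ENNReal.ofReal (1 - p) * φ false := by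
  simp [bernoulliLaw, lintegral_add_measure, lintegral_smul_measure, lintegral_dirac]

lemma e1_nonneg {Cd Cr α d0 : ℝ} (hCd : 0 < Cd) (hCr : 0 < Cr) (hd0 : 0 < d0) (N : ℕ) :
    0 ≤ e1 Cd Cr α d0 N := by
  unfold e1
  positivity

/-- The profile of a transmitter whose cluster type is known. -/
noncomputable def clusterProfile (Cd Cr α d0 : ℝ) (N : ℕ) (s : ℝ) (b : Bool) : ℝ → ℝ :=
  if b then rayleighProfile α (e1 Cd Cr α d0 N * s) else rayleighProfile α (Cd * s)

/-- The profile of a transmitter, averaged over the cluster type. -/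
noncomputable def meanProfile (Cd Cr α d0 p : ℝ) (N : ℕ) (s r : ℝ) : ℝ :=
  p * rayleighProfile α (e1 Cd Cr α d0 N * s) r + (1 - p) * rayleighProfile α (Cd * s) r

section Power

variable {Cd Cr α d0 p : ℝ} (N : ℕ) (hα : 2 < α) (hCd : 0 < Cd) (hCr : 0 < Cr) (hd0 : 0 < d0)
include hα hCd hCr hd0

lemma isRadialProfile_clusterProfile {s : ℝ} (hs : 0 ≤ s) (b : Bool) :
    IsRadialProfile (clusterProfile Cd Cr α d0 N s b) := by
  have he := e1_nonneg (α := α) hCd hCr hd0 N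
  cases b
  · exact isRadialProfile_rayleighProfile hα (by positivity)
  · exact isRadialProfile_rayleighProfile hα (by positivity)

lemma isRadialProfile_meanProfile (hp : p ∈ Icc (0 : ℝ) 1) {s : ℝ} (hs : 0 ≤ s) :
    IsRadialProfile (meanProfile Cd Cr α d0 p N s) :=
  (isRadialProfile_clusterProfile N hα hCd hCr hd0 hs true).convexComb
    (isRadialProfile_clusterProfile N hα hCd hCr hd0 hs false) hp

lemma exp_neg_radialTail_meanProfile {lam s d : ℝ} (hs : 0 ≤ s)
    (hd : 0 < d) :
    Real.exp (-(lam * (2 * Real.pi * radialTail (meanProfile Cd Cr α d0 p N s) d)))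
      = En1 lam p α Cd Cr d0 N d s * En2 lam p α Cd d s := by
  have he := e1_nonneg (α := α) hCd hCr hd0 N
  have h1 := two_mul_radialTail_rayleighProfile hα (mul_nonneg he hs) hd
  have h2 := two_mul_radialTail_rayleighProfile hα (mul_nonneg hCd.le hs) hd
  have h := radialTail_convexComb (p := p)
    (isRadialProfile_rayleighProfile hα (mul_nonneg he hs))
    (isRadialProfile_rayleighProfile hα (mul_nonneg hCd.le hs)) hd.le
  rw [mul_right_comm] at h1 h2
  unfold meanProfile
  rw [h, En1, En2, ← Real.exp_add]
  congr 1
  linear_combination (-(lam * Real.pi * p)) * h1 - lam * Real.pi * (1 - p) * h2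

/-- The bound 1 - 1/(1 + x) ≤ x makes the tail at most K s, linear in s; here s = 1/(n + 1). -/
lemma tendsto_radialTail_meanProfile {d : ℝ} (hp : p ∈ Icc (0 : ℝ) 1) (hd : 0 < d) :
    Tendsto (fun n : ℕ => radialTail (meanProfile Cd Cr α d0 p N (1 / (n + 1))) d) atTop (𝓝 0) := by
  have he := e1_nonneg (α := α) hCd hCr hd0 N
  set K : ℝ := (p * e1 Cd Cr α d0 N + (1 - p) * Cd) * ∫ r in Ioi d, r ^ (1 - α)
  refine squeeze_zero (g := fun n : ℕ => K * (1 / ((n : ℝ) + 1)))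
    (fun n => (isRadialProfile_meanProfile N hα hCd hCr hd0 hp (by positivity)).radialTail_nonneg d)
    (fun n => ?_) ?_
  · have hs : 0 ≤ 1 / ((n : ℝ) + 1) := by positivity
    have h1 := radialTail_rayleighProfile_le hα (mul_nonneg he hs) hd
    have h2 := radialTail_rayleighProfile_le hα (mul_nonneg hCd.le hs) hd
    have h := radialTail_convexComb (p := p)
      (isRadialProfile_rayleighProfile hα (mul_nonneg he hs))
      (isRadialProfile_rayleighProfile hα (mul_nonneg hCd.le hs)) hd.le
    unfold meanProfile
    rw [h]
    have h3 := mul_le_mul_of_nonneg_left h1 hp.1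
    have h4 := mul_le_mul_of_nonneg_left h2 (sub_nonneg.2 hp.2)
    refine (add_le_add h3 h4).trans (le_of_eq ?_)
    ring
  · simpa using tendsto_one_div_add_atTop_nhds_zero_nat.const_mul K

/-- The Laplace transform of the power received from a transmitter whose cluster type is known. -/
lemma lintegral_expNeg_receivedPower {s r : ℝ} (hs : 0 ≤ s) (hr : 0 ≤ r) (b : Bool) :
    ∫⁻ z, expNeg (ENNReal.ofReal s * ENNReal.ofReal (receivedPower Cd Cr α d0 b r r z.1 z.2))
        ∂((complexNormal 1).prod (complexNormal (N : ℝ≥0)))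
      = expNeg (ENNReal.ofReal (-Real.log (clusterProfile Cd Cr α d0 N s b r))) := by
  have hv := isRadialProfile_clusterProfile N hα hCd hCr hd0 hs b
  rw [expNeg_ofReal_neg_log (hv.pos r hr) (hv.le_one r hr)]
  have hpow (z : ℂ × ℂ) : 0 ≤ receivedPower Cd Cr α d0 b r r z.1 z.2 := by
    unfold receivedPower
    split_ifs <;> positivity
  have hdl : 0 ≤ directLoss Cd α r := by unfold directLoss; positivity
  have hrl : 0 ≤ reflectedLoss Cr α d0 r := by unfold reflectedLoss; positivity
  -- A missing surface is treated as a reflected coefficient 0, so one Gaussian formula covers both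
  -- cluster types. With a surface the variance is C_d r^{-α} + N C_r (d₀ r)^{-α} = e₁ r^{-α}.
  have h1 (z : ℂ × ℂ) : expNeg (ENNReal.ofReal s *
      ENNReal.ofReal (receivedPower Cd Cr α d0 b r r z.1 z.2))
      = ENNReal.ofReal (Real.exp (-(s * ‖((√(directLoss Cd α r) : ℝ) : ℂ) * z.1 +
        ((if b then √(reflectedLoss Cr α d0 r) else 0 : ℝ) : ℂ) * z.2‖ ^ 2))) := by
    rw [← ENNReal.ofReal_mul hs, expNeg_ofReal (mul_nonneg hs (hpow z))]
    cases b <;> simp [receivedPower]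
  simp only [h1]
  rw [lintegral_exp_neg_mul_norm_sq_complexNormal _ _ _ _ hs, Real.sq_sqrt hdl]
  congr 1
  cases b
  · simp only [Bool.false_eq_true, if_false, clusterProfile, rayleighProfile, directLoss]
    congr 2
    push_cast
    ring
  · simp only [if_true, clusterProfile, rayleighProfile, e1]
    rw [Real.sq_sqrt hrl, directLoss, reflectedLoss, Real.mul_rpow hd0.le hr]
    congr 2
    push_cast
    ring

lemma lintegral_expNeg_clusterProfile {s r : ℝ} (hp : p ∈ Icc (0 : ℝ) 1) (hs : 0 ≤ s)
    (hr : 0 ≤ r) :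
    ∫⁻ b, expNeg (ENNReal.ofReal (-Real.log (clusterProfile Cd Cr α d0 N s b r)))
        ∂(bernoulliLaw p)
      = expNeg (ENNReal.ofReal (-Real.log (meanProfile Cd Cr α d0 p N s r))) := by
  have hv := isRadialProfile_meanProfile N hα hCd hCr hd0 hp hs
  have hc := isRadialProfile_clusterProfile N hα hCd hCr hd0 hs
  have h1p := sub_nonneg.2 hp.2
  rw [lintegral_bernoulliLaw, expNeg_ofReal_neg_log (hv.pos r hr) (hv.le_one r hr),
    expNeg_ofReal_neg_log ((hc _).pos r hr) ((hc _).le_one r hr),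
    expNeg_ofReal_neg_log ((hc _).pos r hr) ((hc _).le_one r hr),
    ← ENNReal.ofReal_mul hp.1, ← ENNReal.ofReal_mul h1p, ← ENNReal.ofReal_add]
  · rfl
  · exact mul_nonneg hp.1 ((hc _).pos r hr).le
  · exact mul_nonneg h1p ((hc _).pos r hr).le

end Power

end RISNetwork

/-! ### Averaging out the marks, and finiteness of the interference -/

namespace RISNetwork

open Filter Topology Set

variable {Ω : Type*} [MeasurableSpace Ω] {μ : Measure Ω} [IsProbabilityMeasure μ]

/-- Independent marks can be averaged out in the Laplace transform of a series. -/
theorem lintegral_mul_expNeg_tsum_of_indepFun {E F : Type*} [MeasurableSpace E]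
    [MeasurableSpace F] {Z : Ω → F} {M : ℕ → Ω → E} (hZM : IndepFun Z (fun ω k => M k ω) μ)
    (hind : iIndepFun M μ) (hZ : AEMeasurable Z μ) (hM : ∀ k, AEMeasurable (M k) μ)
    {u : ℕ → F → E → ℝ≥0∞} (hu : ∀ k, Measurable (Function.uncurry (u k)))
    {w : ℕ → F → ℝ≥0∞} (hw : ∀ k z, ∫⁻ ω, expNeg (u k z (M k ω)) ∂μ = expNeg (w k z))
    {H : F → ℝ≥0∞} (hH : Measurable H) :
    ∫⁻ ω, H (Z ω) * expNeg (∑' k, u k (Z ω) (M k ω)) ∂μ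
      = ∫⁻ ω, H (Z ω) * expNeg (∑' k, w k (Z ω)) ∂μ := by
  have hMs : AEMeasurable (fun ω k => M k ω) μ := aemeasurable_pi_iff.2 hM
  rw [lintegral_indepFun hZM hZ hMs (Φ := fun z m => H z * expNeg (∑' k, u k z (m k)))]
  · refine lintegral_congr fun ω => ?_
    have hu' (k : ℕ) : Measurable (u k (Z ω)) := (hu k).comp measurable_prodMk_left
    rw [lintegral_const_mul'', lintegral_expNeg_tsum_of_iIndepFun hind hM hu' fun k => hw k (Z ω)]
    exact measurable_expNeg.comp_aemeasurable
      (AEMeasurable.tsum fun k => (hu' k).comp_aemeasurable (hM k))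
  · refine (hH.comp measurable_fst).mul (measurable_expNeg.comp (Measurable.tsum fun k => ?_))
    exact (hu k).comp (measurable_fst.prodMk ((measurable_pi_apply k).comp measurable_snd))

omit [IsProbabilityMeasure μ] in
lemma lintegral_comp_hasLaw {E : Type*} [MeasurableSpace E] {Y : Ω → E} {ν : Measure E}
    (hY : HasLaw Y ν μ) {φ : E → ℝ≥0∞} (hφ : Measurable φ) :
    ∫⁻ ω, φ (Y ω) ∂μ = ∫⁻ y, φ y ∂ν := by
  rw [← hY.map_eq, lintegral_map' hφ.aemeasurable hY.aemeasurable]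

lemma measurable_receivedPower (Cd Cr α d0 : ℝ) :
    Measurable fun z : (Bool × ℝ) × (ℂ × ℂ) =>
      receivedPower Cd Cr α d0 z.1.1 z.1.2 z.1.2 z.2.1 z.2.2 := by
  unfold receivedPower directLoss reflectedLoss
  refine Measurable.ite (measurable_fst.fst (measurableSet_singleton true)) ?_ ?_ <;> fun_prop

/-- The index of the nearest point, as a function of the configuration. -/
noncomputable def nearest (x : ℕ → Plane) : ℕ := servingIndex (fun k (x : ℕ → Plane) => x k) x

lemma measurable_nearest : Measurable nearest :=
  measurable_servingIndex fun k => measurable_pi_apply k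

/-- The contribution of the `k`-th transmitter to the interference, given the configuration `z` of
the transmitters and of their cluster types and the fading `y`. -/
noncomputable def contribution (Cd Cr α d0 : ℝ) (k : ℕ) (z : ℕ → Plane × Bool) (y : ℂ × ℂ) :
    ℝ≥0∞ :=
  if k = nearest (fun j => (z j).1) then 0 else
    ENNReal.ofReal (receivedPower Cd Cr α d0 (z k).2 ‖(z k).1‖ ‖(z k).1‖ y.1 y.2)

lemma measurable_contribution (Cd Cr α d0 : ℝ) (k : ℕ) :
    Measurable (Function.uncurry (contribution Cd Cr α d0 k)) := by
  have h1 : Measurable fun z : (ℕ → Plane × Bool) × (ℂ × ℂ) => nearest fun j => (z.1 j).1 :=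
    measurable_nearest.comp (by fun_prop)
  refine Measurable.ite (measurableSet_eq_fun measurable_const h1) measurable_const ?_
  exact ((measurable_receivedPower Cd Cr α d0).comp
    (f := fun z : (ℕ → Plane × Bool) × (ℂ × ℂ) => (((z.1 k).2, ‖(z.1 k).1‖), z.2))
    (by fun_prop)).ennreal_ofReal

section Network

variable {lam : ℝ≥0} {p α Cd Cr d0 : ℝ} {N : ℕ} {tx ris : ℕ → Ω → Plane} {hasRIS : ℕ → Ω → Bool}
  {g f : ℕ → Ω → ℂ}

variable (hα : 2 < α) (hCd : 0 < Cd) (hCr : 0 < Cr) (hd0 : 0 < d0)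
  (hgpp : IsGaussPoissonProcess μ lam p d0 tx hasRIS ris) (hfading : IsFading μ N g f)

include hgpp

omit [IsProbabilityMeasure μ] in
lemma aemeasurable_hasRIS (k : ℕ) : AEMeasurable (hasRIS k) μ :=
  measurable_fst.comp_aemeasurable (hgpp.cluster_law k).aemeasurable

omit [IsProbabilityMeasure μ] in
lemma hasLaw_hasRIS (k : ℕ) : HasLaw (hasRIS k) (bernoulliLaw p) μ where
  aemeasurable := aemeasurable_hasRIS hgpp k
  map_eq := by
    have h := congrArg (Measure.map Prod.fst) (hgpp.cluster_law k).map_eq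
    rw [AEMeasurable.map_map_of_aemeasurable measurable_fst.aemeasurable
      (hgpp.cluster_law k).aemeasurable, Measure.map_fst_prod, measure_univ, one_smul] at h
    exact h

omit [IsProbabilityMeasure μ] in
lemma aemeasurable_config : AEMeasurable (fun ω j => (tx j ω, hasRIS j ω)) μ :=
  aemeasurable_pi_iff.2 fun k =>
    (hgpp.parents.measurable k).aemeasurable.prodMk (aemeasurable_hasRIS hgpp k)

include hfading

omit [IsProbabilityMeasure μ] in
lemma aemeasurable_interference : AEMeasurable (interference Cd Cr α d0 tx hasRIS g f) μ := by
  have h (k : ℕ) : AEMeasurable (fun ω => Function.uncurry (contribution Cd Cr α d0 k)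
      (fun j => (tx j ω, hasRIS j ω), (g k ω, f k ω))) μ :=
    (measurable_contribution Cd Cr α d0 k).comp_aemeasurable
      ((aemeasurable_config hgpp).prodMk (hfading.law k).aemeasurable)
  exact AEMeasurable.tsum h

variable (hindep : IndepFun (fun ω k => (tx k ω, hasRIS k ω, ris k ω))
  (fun ω k => (g k ω, f k ω)) μ)

include hα hCd hCr hd0 hindep

/-- The joint Laplace transform of the interference and the serving distance. -/
theorem lintegral_mul_expNeg_interference (hlam : 0 < lam) (hp : p ∈ Icc (0 : ℝ) 1) {s : ℝ}
    (hs : 0 ≤ s) {h : ℝ → ℝ≥0∞} (hh : Measurable h) :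
    ∫⁻ ω, h (servingDist tx ω) *
        expNeg (ENNReal.ofReal s * interference Cd Cr α d0 tx hasRIS g f ω) ∂μ
      = ∫⁻ ω, h (servingDist tx ω) * ENNReal.ofReal (Real.exp (-(lam * (2 * Real.pi *
          radialTail (meanProfile Cd Cr α d0 p N s) (servingDist tx ω))))) ∂μ := by
  have hdist : Measurable fun x : ℕ → Plane => ‖x (nearest x)‖ :=
    measurable_servingDist (X := fun k (x : ℕ → Plane) => x k) fun k => measurable_pi_apply k
  have hc := isRadialProfile_clusterProfile N hα hCd hCr hd0 hs
  have hind1 : IndepFun (fun ω j => (tx j ω, hasRIS j ω)) (fun ω k => (g k ω, f k ω)) μ :=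
    hindep.comp (φ := fun (z : ℕ → Plane × Bool × Plane) j => ((z j).1, (z j).2.1))
      (ψ := fun z : ℕ → ℂ × ℂ => z) (by fun_prop) measurable_id
  have hind2 : IndepFun (fun ω k => tx k ω) (fun ω k => hasRIS k ω) μ :=
    hgpp.parents_indep.comp (φ := fun z : ℕ → Plane => z)
      (ψ := fun (z : ℕ → Bool × Plane) k => (z k).1) measurable_id (by fun_prop)
  have hind3 : iIndepFun hasRIS μ :=
    hgpp.cluster_indep.comp (fun _ z => z.1) fun _ => measurable_fst
  -- The fading is averaged with positions and cluster types frozen. The nearest index depends on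
  -- positions only, so it is frozen too.
  have step1 := lintegral_mul_expNeg_tsum_of_indepFun hind1 hfading.indep
    (aemeasurable_config hgpp) (fun k => (hfading.law k).aemeasurable)
    (u := fun k z y => ENNReal.ofReal s * contribution Cd Cr α d0 k z y)
    (w := fun k z => if k = nearest (fun j => (z j).1) then 0 else
      ENNReal.ofReal (-Real.log (clusterProfile Cd Cr α d0 N s (z k).2 ‖(z k).1‖)))
    (fun k => (measurable_contribution Cd Cr α d0 k).const_mul _) (fun k z => ?_)
    (H := fun z => h ‖(z (nearest fun j => (z j).1)).1‖)
    (hh.comp (hdist.comp (g := fun x : ℕ → Plane => ‖x (nearest x)‖)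
      (f := fun (z : ℕ → Plane × Bool) j => (z j).1) (by fun_prop)))
  -- The cluster types are averaged next, with the positions frozen, leaving a functional of the
  -- Poisson process alone.
  have step2 := lintegral_mul_expNeg_tsum_of_indepFun hind2 hind3
    (aemeasurable_pi_iff.2 fun k => (hgpp.parents.measurable k).aemeasurable)
    (aemeasurable_hasRIS hgpp)
    (u := fun k x b => if k = nearest x then 0 else
      ENNReal.ofReal (-Real.log (clusterProfile Cd Cr α d0 N s b ‖x k‖)))
    (w := fun k x => if k = nearest x then 0 else
      ENNReal.ofReal (-Real.log (meanProfile Cd Cr α d0 p N s ‖x k‖)))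
    (fun k => ?_) (fun k x => ?_) (H := fun x => h ‖x (nearest x)‖) (hh.comp hdist)
  · simp only [ENNReal.tsum_mul_left] at step1
    exact step1.trans (step2.trans (hgpp.parents.lintegral_mul_expNeg_tsum_ite hlam
      (isRadialProfile_meanProfile N hα hCd hCr hd0 hp hs) hh))
  · refine Measurable.ite (measurableSet_eq_fun measurable_const
      (measurable_nearest.comp measurable_fst)) measurable_const ?_
    have hm : Measurable fun z : Bool × ℝ => clusterProfile Cd Cr α d0 N s z.1 z.2 :=
      measurable_from_prod_countable_right fun b => (hc b).measurable
    exact (Real.measurable_log.comp (hm.comp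
      (f := fun z : (ℕ → Plane) × Bool => (z.2, ‖z.1 k‖)) (by fun_prop))).neg.ennreal_ofReal
  · by_cases hk : k = nearest x
    · simp [hk]
    · simp only [if_neg hk]
      rw [lintegral_comp_hasLaw (hasLaw_hasRIS hgpp k) (φ := fun b => expNeg (ENNReal.ofReal
        (-Real.log (clusterProfile Cd Cr α d0 N s b ‖x k‖)))) (measurable_of_countable _)]
      exact lintegral_expNeg_clusterProfile N hα hCd hCr hd0 hp hs (norm_nonneg _)
  · by_cases hk : k = nearest (fun j => (z j).1)
    · simp [contribution, hk]
    · simp only [contribution, if_neg hk]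
      rw [← lintegral_expNeg_receivedPower N hα hCd hCr hd0 hs (norm_nonneg _),
        ← lintegral_comp_hasLaw (hfading.law k)]
      have hm := (measurable_receivedPower Cd Cr α d0).comp
        (measurable_prodMk_left (β := ℂ × ℂ) (x := ((z k).2, ‖(z k).1‖)))
      exact measurable_expNeg.comp (hm.ennreal_ofReal.const_mul _)

/-- For s > 0, e^{-sI} vanishes where I = ∞, so E e^{-sI} ≤ P(I < ∞). Along s = 1/(n + 1) the
explicit left side tends to 1 by dominated convergence. -/
theorem interference_lt_top (hlam : 0 < lam) (hp : p ∈ Icc (0 : ℝ) 1) :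
    ∀ᵐ ω ∂μ, interference Cd Cr α d0 tx hasRIS g f ω < ∞ := by
  have hI : AEMeasurable (interference Cd Cr α d0 tx hasRIS g f) μ :=
    aemeasurable_interference hgpp hfading
  have hS : NullMeasurableSet {ω | interference Cd Cr α d0 tx hasRIS g f ω < ∞} μ :=
    hI.nullMeasurableSet_preimage measurableSet_Iio
  have hD := measurable_servingDist hgpp.parents.measurable
  have hle (n : ℕ) : ∫⁻ ω, ENNReal.ofReal (Real.exp (-(lam * (2 * Real.pi *
      radialTail (meanProfile Cd Cr α d0 p N (1 / (n + 1))) (servingDist tx ω))))) ∂μ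
      ≤ μ {ω | interference Cd Cr α d0 tx hasRIS g f ω < ∞} := by
    have hn : (0 : ℝ) < 1 / (n + 1) := by positivity
    have h := lintegral_mul_expNeg_interference hα hCd hCr hd0 hgpp hfading hindep hlam hp hn.le
      (h := fun _ => 1) measurable_const
    simp only [one_mul] at h
    rw [← h, ← lintegral_indicator_one₀ hS]
    refine lintegral_mono fun ω => ?_
    by_cases hω : interference Cd Cr α d0 tx hasRIS g f ω < ∞
    · rw [indicator_of_mem (show ω ∈ {ω | interference Cd Cr α d0 tx hasRIS g f ω < ∞} from hω)]
      exact expNeg_le_one _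
    · rw [not_lt_top_iff.1 hω, ENNReal.mul_top (ENNReal.ofReal_pos.2 hn).ne', expNeg_top]
      exact zero_le
  have hlim : Tendsto (fun n : ℕ => ∫⁻ ω, ENNReal.ofReal (Real.exp (-(lam * (2 * Real.pi *
      radialTail (meanProfile Cd Cr α d0 p N (1 / (n + 1))) (servingDist tx ω))))) ∂μ)
      atTop (𝓝 (∫⁻ _, 1 ∂μ)) := by
    have hv (n : ℕ) := isRadialProfile_meanProfile (α := α) N hα hCd hCr hd0 hp
      (s := 1 / ((n : ℝ) + 1)) (by positivity)
    refine tendsto_lintegral_of_dominated_convergence (fun _ => 1) (fun n => ?_)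
      (fun n => ae_of_all _ fun ω => ?_) (by simp) ?_
    · have := (hv n).continuous_radialTail.measurable
      fun_prop
    · refine ENNReal.ofReal_le_one.2 (Real.exp_le_one_iff.2 ?_)
      have := (hv n).radialTail_nonneg (servingDist tx ω)
      have := Real.pi_pos
      exact neg_nonpos.2 (by positivity)
    · filter_upwards [hgpp.parents.servingDist_pos] with ω hω
      have h1 := tendsto_radialTail_meanProfile N hα hCd hCr hd0 hp hω
      have h2 := (((h1.const_mul (2 * Real.pi)).const_mul (lam : ℝ)).neg).rexp
      simpa using ENNReal.tendsto_ofReal h2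
  have h1 : μ {ω | interference Cd Cr α d0 tx hasRIS g f ω < ∞} = 1 :=
    le_antisymm prob_le_one (by simpa using le_of_tendsto' hlim hle)
  exact (prob_compl_eq_zero_iff₀ hS).2 h1

end Network

end RISNetwork

/-! ### The conditional Laplace transform -/

open RISNetwork in
theorem proposition2 {Ω : Type*} [MeasurableSpace Ω] (μ : Measure Ω) [IsProbabilityMeasure μ]
    (lam : ℝ≥0) (p α Cd Cr d0 : ℝ) (N : ℕ)
    (hlam : 0 < lam) (hp : p ∈ Set.Icc (0 : ℝ) 1) (hα : 2 < α)
    (hCd : 0 < Cd) (hCr : 0 < Cr) (hd0 : 0 < d0)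
    (tx ris : ℕ → Ω → RISNetwork.Plane) (hasRIS : ℕ → Ω → Bool) (g f : ℕ → Ω → ℂ)
    (hgpp : RISNetwork.IsGaussPoissonProcess μ lam p d0 tx hasRIS ris)
    (hfading : RISNetwork.IsFading μ N g f)
    (hindep : IndepFun (fun ω k => (tx k ω, hasRIS k ω, ris k ω))
      (fun ω k => (g k ω, f k ω)) μ) :
    (∀ᵐ ω ∂μ, RISNetwork.interference Cd Cr α d0 tx hasRIS g f ω < ∞) ∧
    ∀ s : ℝ, 0 ≤ s →
      μ[fun ω => Real.exp (-s * (RISNetwork.interference Cd Cr α d0 tx hasRIS g f ω).toReal) |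
          MeasurableSpace.comap (RISNetwork.servingDist tx) inferInstance]
        =ᵐ[μ] fun ω =>
          RISNetwork.En1 lam p α Cd Cr d0 N (RISNetwork.servingDist tx ω) s *
            RISNetwork.En2 lam p α Cd (RISNetwork.servingDist tx ω) s := by
  have hfin := interference_lt_top hα hCd hCr hd0 hgpp hfading hindep hlam hp
  refine ⟨hfin, fun s hs => ?_⟩
  have hD := measurable_servingDist hgpp.parents.measurable
  have hI : AEMeasurable (interference Cd Cr α d0 tx hasRIS g f) μ :=
    aemeasurable_interference hgpp hfading
  have hv := isRadialProfile_meanProfile N hα hCd hCr hd0 hp hs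
  -- The radial-tail form of the answer is measurable by continuity of the tail, so measurability of
  -- the hypergeometric expression is not needed; the two agree where the serving distance is
  -- positive, hence almost surely.
  set c : ℝ → ℝ := fun d =>
    Real.exp (-(lam * (2 * Real.pi * radialTail (meanProfile Cd Cr α d0 p N s) d))) with hc
  have hcm : Measurable c := by
    have := hv.continuous_radialTail.measurable
    fun_prop
  have hc1 (d : ℝ) : c d ≤ 1 := by
    have := hv.radialTail_nonneg d
    have := Real.pi_pos
    exact Real.exp_le_one_iff.2 (neg_nonpos.2 (by positivity))
  have hceq : (fun ω => c (servingDist tx ω)) =ᵐ[μ] fun ω =>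
      En1 lam p α Cd Cr d0 N (servingDist tx ω) s * En2 lam p α Cd (servingDist tx ω) s := by
    filter_upwards [hgpp.parents.servingDist_pos] with ω hω
    exact exp_neg_radialTail_meanProfile N hα hCd hCr hd0 hs hω
  have hFm : AEMeasurable
      (fun ω => Real.exp (-s * (interference Cd Cr α d0 tx hasRIS g f ω).toReal)) μ :=
    Real.measurable_exp.comp_aemeasurable (hI.ennreal_toReal.const_mul _)
  have hFint : Integrable
      (fun ω => Real.exp (-s * (interference Cd Cr α d0 tx hasRIS g f ω).toReal)) μ := by
    refine Integrable.of_bound hFm.aestronglyMeasurable 1 (ae_of_all _ fun ω => ?_)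
    rw [Real.norm_of_nonneg (Real.exp_pos _).le, Real.exp_le_one_iff, neg_mul]
    exact neg_nonpos.2 (mul_nonneg hs ENNReal.toReal_nonneg)
  have hcint : Integrable (fun ω => c (servingDist tx ω)) μ := by
    refine Integrable.of_bound (hcm.comp hD).aestronglyMeasurable 1 (ae_of_all _ fun ω => ?_)
    rw [Real.norm_of_nonneg (Real.exp_pos _).le]
    exact hc1 _
  refine (Filter.EventuallyEq.trans ?_ hceq :)
  refine (ae_eq_condExp_of_forall_setIntegral_eq hD.comap_le hFint
    (fun _ _ _ => hcint.integrableOn) ?_ ?_).symm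
  -- Events of the conditioning σ-algebra are preimages of Borel sets B under the serving distance,
  -- so the joint transform is used with h the indicator of B.
  · rintro _ ⟨B, hB, rfl⟩ -
    have hDB : MeasurableSet (servingDist tx ⁻¹' B) := hD hB
    rw [integral_eq_lintegral_of_nonneg_ae (ae_of_all _ fun ω => (Real.exp_pos _).le)
        (hcm.comp hD).aestronglyMeasurable,
      integral_eq_lintegral_of_nonneg_ae (ae_of_all _ fun ω => (Real.exp_pos _).le)
        hFm.aestronglyMeasurable.restrict]
    congr 1
    have h := lintegral_mul_expNeg_interference hα hCd hCr hd0 hgpp hfading hindep hlam hp hs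
      (h := B.indicator 1) (measurable_one.indicator hB)
    rw [← lintegral_indicator hDB, ← lintegral_indicator hDB]
    refine Eq.trans ?_ (h.symm.trans ?_)
    · refine lintegral_congr fun ω => ?_
      by_cases hω : servingDist tx ω ∈ B <;> simp [Set.indicator, hω]
    · refine lintegral_congr_ae ?_
      filter_upwards [hfin] with ω hω
      have h1 : expNeg (ENNReal.ofReal s * interference Cd Cr α d0 tx hasRIS g f ω)
          = ENNReal.ofReal
            (Real.exp (-s * (interference Cd Cr α d0 tx hasRIS g f ω).toReal)) := by
        rw [expNeg_of_ne_top (ENNReal.mul_ne_top ENNReal.ofReal_ne_top hω.ne),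
          ENNReal.toReal_mul, ENNReal.toReal_ofReal hs, neg_mul]
      rw [h1]
      by_cases hω : servingDist tx ω ∈ B <;> simp [Set.indicator, hω]
  · exact (hcm.stronglyMeasurable.comp_measurable
      (comap_measurable (servingDist tx))).aestronglyMeasurable
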